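/- **Setting.** Let $K$ be a field, $P=K[x_1,\dots,x_n]$, let $W$ be an integer $m\times n$ matrix of rank $m\ge 1$, and let $\overline P=K[y_1,\dots,y_m,x_1,\dots,x_n]$ be graded by $\overline W=(I_m\mid W)$. Let $F=P^r$ and $\overline F=\bigoplus_{i=1}^r\overline P(-\delta_i)$ with $\delta_i=\deg e_i\in\mathbb Z^m$. The dehomogenization $U^{\rm deh}\in F$ of $U\in\overline F$ is obtained by putting $y_1=\dots=y_m=1$; the homogenization $v^{\rm hom}$ of $v\in F\setminus\{0\}$ is obtained by multiplying every term $T$ of $v$ by $y^{\mu-\deg T}$, where $\deg(x^ae_i)=Wa+\delta_i$ and $\mu$ is the componentwise maximum of the degrees of the terms of $v$, and $0^{\rm hom}=0$. Put $U^{\rm sat}=(U^{\rm deh})^{\rm hom}$; for a graded submodule $N\subseteq\overline F$ put $N^{\rm deh}=\{U^{\rm deh}: U\in N\}$ and $N^{\rm sat}=\langle v^{\rm hom}: v\in N^{\rm deh}\rangle$. Let $\sigma$ be a module ordering on the terms of $F$ (compatible with a monoid ordering), and let $\overline\sigma$ be its extension to the terms of $\overline F$: $T>_{\overline\sigma}T'$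 iff $\deg T>\deg T'$ in the lexicographic order of $\mathbb Z^m$, or $\deg T=\deg T'$ and $T^{\rm deh}>_\sigma T'^{\rm deh}$. A module ordering is a *module term ordering* if $te_i>e_i$ for all $i$ and all power products $t\neq1$. A $\sigma$-Gröbner basis of a submodule $M$ is a finite set of non-zero vectors that generates $M$ and whose leading terms generate the module of leading terms of $M$; likewise for $\overline\sigma$. A finite set $\{V_1,\dots,V_t\}$ of non-zero homogeneous vectors of $\overline F$ is * a *$\sigma$-DehomBasis* for $N$ if $\{V_1^{\rm deh},\dots,V_t^{\rm deh}\}$ is a $\sigma$-Gröbner basis of $N^{\rm deh}$; * a *$\overline\sigma$-SatGBasis* for $N$ if it is a $\overline\sigma$-Gröbner basis of some graded submodule $\tilde N\subseteq\overline F$ with $\tilde N^{\rm sat}=N^{\rm sat}$. **Algorithms.** Given $(U_1,\dots,U_s)$, start with ${\rm Gens}=(U_1,\dots,U_s)$, ${\rm Pairs}=\emptyset$, $\mathcal G=\emptyset$. While ${\rm Gens}\ne\emptyset$ or ${\rm Pairs}\ne\emptyset$: (2a) remove some $w$ from ${\rm Gens}$, or remove some pair from ${\rm Pairs}$ and let $w$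 be its S-vector; (2b) compute a remainder $v$ of $w$ by $\mathcal G$; (2c) if $v\ne0$, add to ${\rm Pairs}$ all pairs $(v,g)$ with $g\in\mathcal G$ whose leading term involves the same $e_i$ as that of $v$, and add $v$ to $\mathcal G$. At the end return $\mathcal G$. A division step by $\mathcal G$ eliminates from a vector a term divisible by the leading term (with respect to $\overline\sigma$) of some $g\in\mathcal G$, by subtracting a multiple of $g$ by a monomial; a remainder is obtained by finitely many division steps, and it is $0$ or its leading term is not divisible by that of any $g\in\mathcal G$. * In a *Weak Self-Saturating Buchberger's Algorithm* (WeakSelfSatBA) the remainder in (2b) is a weak saturating remainder: before each division step, and at the end, the current vector may be replaced by any homogeneous vector with the same saturation, and the final vector is again $0$ or has a leading term not divisible by that of any $g\in\mathcal G$. * In the *Self-Saturating Buchberger's Algorithm* (SelfSatBA) the remainder in (2b) is $R^{\rm sat}$, where $R$ is an ordinary remainder of $w$ by $\mathcal G$. **Theorem.** Let $U_1,\dots,U_s$ be homogeneous vectors in $\overline F$ and let $N$ be the graded submodule of $\overline F$ generated by them. 1. If $\sigma$ is a module term ordering, then every WeakSelfSatBA applied to $(U_1,\dots,U_s)$ computes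 a $\sigma$-DehomBasis for $N$. 2. If $\sigma$ or $\overline\sigma$ is a module term ordering (the latter holds, for instance, if the first non-zero entry of each column of $W$ exists and is positive), then SelfSatBA applied to $(U_1,\dots,U_s)$ computes a $\overline\sigma$-SatGBasis for $N$. Here "computes" means that, whatever choices are made, all the divisions and the main loop terminate, the main loop can always be continued until ${\rm Gens}={\rm Pairs}=\emptyset$, and the $\mathcal G$ returned is then of the stated kind. -/

import Mathlib

namespace SatBA

open MvPolynomial Relation

/-! ### Vectors, terms and module orderings -/

/-- Vectors of the free module `R^r` over the polynomial ring `R = K[X_j | j ∈ ι]`. -/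
abbrev Vec (ι : Type) (r : ℕ) (K : Type*) [Field K] := Fin r → MvPolynomial ι K

/-- The pair `(i, a)` stands for the term `X^a e_i`. -/
abbrev Term (ι : Type) (r : ℕ) := Fin r × (ι →₀ ℕ)

/-- A monoid ordering on the power products `X^a`, given by its strict relation. -/
structure IsMonoidOrdering {ι : Type} (τ : (ι →₀ ℕ) → (ι →₀ ℕ) → Prop) : Prop where
  total : IsStrictTotalOrder (ι →₀ ℕ) τ
  mul : ∀ c a b, τ a b → τ (c + a) (c + b)

/-- A module ordering on the terms `X^a e_i` (given by its strict relation, `lt T T'` meaning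
`T < T'`), compatible with some monoid ordering. -/
structure IsModuleOrdering {ι : Type} {r : ℕ} (lt : Term ι r → Term ι r → Prop) : Prop where
  total : IsStrictTotalOrder (Term ι r) lt
  mul : ∀ (c : ι →₀ ℕ) (i j : Fin r) (a b : ι →₀ ℕ), lt (i, a) (j, b) → lt (i, c + a) (j, c + b)
  compatible : ∃ τ : (ι →₀ ℕ) → (ι →₀ ℕ) → Prop, IsMonoidOrdering τ ∧
    ∀ (i : Fin r) (a b : ι →₀ ℕ), τ a b → lt (i, a) (i, b)

/-- A module term ordering: a module ordering with `e_i < X^a e_i` for every `X^a ≠ 1`. -/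
structure IsModuleTermOrdering {ι : Type} {r : ℕ} (lt : Term ι r → Term ι r → Prop) : Prop
    extends IsModuleOrdering lt where
  pos : ∀ (i : Fin r) (a : ι →₀ ℕ), a ≠ 0 → lt (i, 0) (i, a)

section Groebner

variable {ι : Type} {r : ℕ} {K : Type*} [Field K]

/-- The coefficient of the term `T` in the vector `v`. -/
noncomputable def tcoeff (v : Vec ι r K) (T : Term ι r) : K := coeff T.2 (v T.1)

/-- `LT(v) = T`. -/
def IsLT (lt : Term ι r → Term ι r → Prop) (v : Vec ι r K) (T : Term ι r) : Prop :=
  tcoeff v T ≠ 0 ∧ ∀ T', tcoeff v T' ≠ 0 → T' = T ∨ lt T' T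

/-- The term `X^a e_i` as a vector. -/
noncomputable def termVec (K : Type*) [Field K] (T : Term ι r) : Vec ι r K :=
  Pi.single T.1 (monomial T.2 1)

/-- The submodule generated by the leading terms of the non-zero elements of `S`. -/
noncomputable def leadingModule (lt : Term ι r → Term ι r → Prop) (S : Set (Vec ι r K)) :
    Submodule (MvPolynomial ι K) (Vec ι r K) :=
  Submodule.span _ {t | ∃ v ∈ S, ∃ T, IsLT lt v T ∧ t = termVec K T}

/-- `G` is a Gröbner basis of the submodule `M`. -/
structure IsGroebnerBasis (lt : Term ι r → Term ι r → Prop)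
    (M : Submodule (MvPolynomial ι K) (Vec ι r K)) (G : Set (Vec ι r K)) : Prop where
  finite : G.Finite
  ne_zero : ∀ g ∈ G, g ≠ 0
  span_eq : Submodule.span _ G = M
  leading : leadingModule lt G = leadingModule lt (M : Set (Vec ι r K))

/-- `w` is the S-vector of `u` and `v`; it exists only if their leading terms involve the same
basis vector `e_i`.  The lcm of `X^a` and `X^b` is `X^(a ⊔ b)`. -/
def IsSVector (lt : Term ι r → Term ι r → Prop) (u v w : Vec ι r K) : Prop :=
  ∃ (i : Fin r) (a b : ι →₀ ℕ), IsLT lt u (i, a) ∧ IsLT lt v (i, b) ∧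
    w = monomial ((a ⊔ b) - a) (tcoeff u (i, a))⁻¹ • u
      - monomial ((a ⊔ b) - b) (tcoeff v (i, b))⁻¹ • v

/-- One step of the division algorithm by `G`: a term `X^(c+b) e_i` of `v` that is divisible by
the leading term `X^b e_i` of some `g ∈ G` is eliminated. -/
def DivStep (lt : Term ι r → Term ι r → Prop) (G : Multiset (Vec ι r K)) (v v' : Vec ι r K) :
    Prop :=
  ∃ g ∈ G, ∃ (i : Fin r) (b c : ι →₀ ℕ), IsLT lt g (i, b) ∧ tcoeff v (i, c + b) ≠ 0 ∧
    v' = v - monomial c (tcoeff v (i, c + b) / tcoeff g (i, b)) • g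

/-- `v` is zero or `LT(v)` is not divisible by `LT(g)` for any `g ∈ G`. -/
def HeadIrreducible (lt : Term ι r → Term ι r → Prop) (G : Multiset (Vec ι r K))
    (v : Vec ι r K) : Prop :=
  ∀ g ∈ G, ∀ (i : Fin r) (a b : ι →₀ ℕ), IsLT lt v (i, a) → IsLT lt g (i, b) → ¬ b ≤ a

/-- `u` is a remainder of `v` by `G`. -/
def IsRem (lt : Term ι r → Term ι r → Prop) (G : Multiset (Vec ι r K)) (v u : Vec ι r K) :
    Prop :=
  ReflTransGen (DivStep lt G) v u ∧ HeadIrreducible lt G u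

end Groebner

/-! ### Homogenization, dehomogenization, saturation

The index `Sum.inl k` belongs to the homogenizing indeterminate `y_k` and `Sum.inr j` to `x_j`. -/

section Homogenization

variable {m n r : ℕ} {K : Type*} [Field K]

/-- `deg_W (x^a e_i) = W a + δ_i`. -/
def degW (W : Matrix (Fin m) (Fin n) ℤ) (δ : Fin r → Fin m → ℤ) (T : Term (Fin n) r) :
    Fin m → ℤ :=
  fun k => ∑ j, W k j * (T.2 j : ℤ) + δ T.1 k

/-- The degree with respect to `(I_m | W)` of a term `y^b x^a e_i`, namely `b + W a + δ_i`. -/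
def degWbar (W : Matrix (Fin m) (Fin n) ℤ) (δ : Fin r → Fin m → ℤ)
    (T : Term (Fin m ⊕ Fin n) r) : Fin m → ℤ :=
  fun k => (T.2 (Sum.inl k) : ℤ) + ∑ j, W k j * (T.2 (Sum.inr j) : ℤ) + δ T.1 k

/-- `(y^b x^a e_i)^deh = x^a e_i`. -/
noncomputable def dehTerm (T : Term (Fin m ⊕ Fin n) r) : Term (Fin n) r :=
  (T.1, Finsupp.equivFunOnFinite.symm fun j => T.2 (Sum.inr j))

/-- The extension of `σ` by `W`: compare degrees in `ℤ^m` lexicographically, then the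
dehomogenized terms by `σ`. -/
def extend (W : Matrix (Fin m) (Fin n) ℤ) (δ : Fin r → Fin m → ℤ)
    (σ : Term (Fin n) r → Term (Fin n) r → Prop) (T T' : Term (Fin m ⊕ Fin n) r) : Prop :=
  toLex (degWbar W δ T) < toLex (degWbar W δ T') ∨
    (degWbar W δ T = degWbar W δ T' ∧ σ (dehTerm T) (dehTerm T'))

/-- All terms of `U` have the same degree. -/
def IsHomog (W : Matrix (Fin m) (Fin n) ℤ) (δ : Fin r → Fin m → ℤ)
    (U : Vec (Fin m ⊕ Fin n) r K) : Prop :=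
  ∃ d : Fin m → ℤ, ∀ T, tcoeff U T ≠ 0 → degWbar W δ T = d

/-- A submodule is graded if it is generated by its homogeneous elements. -/
def IsGraded (W : Matrix (Fin m) (Fin n) ℤ) (δ : Fin r → Fin m → ℤ)
    (N : Submodule (MvPolynomial (Fin m ⊕ Fin n) K) (Vec (Fin m ⊕ Fin n) r K)) : Prop :=
  Submodule.span _ {U | U ∈ N ∧ IsHomog W δ U} = N

/-- `U^deh = U(1, …, 1, x_1, …, x_n)`. -/
noncomputable def deh (U : Vec (Fin m ⊕ Fin n) r K) : Vec (Fin n) r K :=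
  fun i => aeval (Sum.elim (fun _ => 1) X : Fin m ⊕ Fin n → MvPolynomial (Fin n) K) (U i)

/-- The top degree of a non-zero vector: the componentwise maximum of the degrees of its terms. -/
noncomputable def topDeg (W : Matrix (Fin m) (Fin n) ℤ) (δ : Fin r → Fin m → ℤ)
    (v : Vec (Fin n) r K) : Fin m → ℤ :=
  fun k => sSup {z | ∃ T, tcoeff v T ≠ 0 ∧ z = degW W δ T k}

/-- The homogenization of a vector: each of its terms `T` is multiplied by `y^(topDeg - deg T)`. -/
noncomputable def hom (W : Matrix (Fin m) (Fin n) ℤ) (δ : Fin r → Fin m → ℤ)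
    (v : Vec (Fin n) r K) : Vec (Fin m ⊕ Fin n) r K :=
  fun i => ∑ a ∈ (v i).support,
    monomial (Finsupp.equivFunOnFinite.symm
      (Sum.elim (fun k => (topDeg W δ v k - degW W δ (i, a) k).toNat) a)) (coeff a (v i))

/-- `U^sat = (U^deh)^hom`. -/
noncomputable def sat (W : Matrix (Fin m) (Fin n) ℤ) (δ : Fin r → Fin m → ℤ)
    (U : Vec (Fin m ⊕ Fin n) r K) : Vec (Fin m ⊕ Fin n) r K :=
  hom W δ (deh U)

/-- `N^deh`, the submodule of the dehomogenizations of the elements of `N`. -/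
noncomputable def dehMod
    (N : Submodule (MvPolynomial (Fin m ⊕ Fin n) K) (Vec (Fin m ⊕ Fin n) r K)) :
    Submodule (MvPolynomial (Fin n) K) (Vec (Fin n) r K) :=
  Submodule.span _ (deh '' (N : Set (Vec (Fin m ⊕ Fin n) r K)))

/-- `M^hom`, the submodule generated by the homogenizations of the elements of `M`. -/
noncomputable def homMod (W : Matrix (Fin m) (Fin n) ℤ) (δ : Fin r → Fin m → ℤ)
    (M : Submodule (MvPolynomial (Fin n) K) (Vec (Fin n) r K)) :
    Submodule (MvPolynomial (Fin m ⊕ Fin n) K) (Vec (Fin m ⊕ Fin n) r K) :=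
  Submodule.span _ (hom W δ '' (M : Set (Vec (Fin n) r K)))

/-- `N^sat = (N^deh)^hom`. -/
noncomputable def satMod (W : Matrix (Fin m) (Fin n) ℤ) (δ : Fin r → Fin m → ℤ)
    (N : Submodule (MvPolynomial (Fin m ⊕ Fin n) K) (Vec (Fin m ⊕ Fin n) r K)) :
    Submodule (MvPolynomial (Fin m ⊕ Fin n) K) (Vec (Fin m ⊕ Fin n) r K) :=
  homMod W δ (dehMod N)

/-- `V` is a `σ`-DehomBasis for `N`. -/
structure IsDehomBasis (W : Matrix (Fin m) (Fin n) ℤ) (δ : Fin r → Fin m → ℤ)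
    (σ : Term (Fin n) r → Term (Fin n) r → Prop)
    (N : Submodule (MvPolynomial (Fin m ⊕ Fin n) K) (Vec (Fin m ⊕ Fin n) r K))
    (V : Set (Vec (Fin m ⊕ Fin n) r K)) : Prop where
  finite : V.Finite
  homog : ∀ v ∈ V, v ≠ 0 ∧ IsHomog W δ v
  groebner : IsGroebnerBasis σ (dehMod N) (deh '' V)

/-- `V` is a `σ̄`-SatGBasis for `N`. -/
structure IsSatGBasis (W : Matrix (Fin m) (Fin n) ℤ) (δ : Fin r → Fin m → ℤ)
    (σ : Term (Fin n) r → Term (Fin n) r → Prop)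
    (N : Submodule (MvPolynomial (Fin m ⊕ Fin n) K) (Vec (Fin m ⊕ Fin n) r K))
    (V : Set (Vec (Fin m ⊕ Fin n) r K)) : Prop where
  homog : ∀ v ∈ V, v ≠ 0 ∧ IsHomog W δ v
  groebner : ∃ N' : Submodule (MvPolynomial (Fin m ⊕ Fin n) K) (Vec (Fin m ⊕ Fin n) r K),
    IsGraded W δ N' ∧ satMod W δ N' = satMod W δ N ∧ IsGroebnerBasis (extend W δ σ) N' V

/-! ### Saturating remainders -/

/-- `V'` is a homogeneous vector with the same saturation as `V`. -/
def SameSat (W : Matrix (Fin m) (Fin n) ℤ) (δ : Fin r → Fin m → ℤ)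
    (V V' : Vec (Fin m ⊕ Fin n) r K) : Prop :=
  IsHomog W δ V' ∧ sat W δ V' = sat W δ V

/-- One step of a weakly saturating division: the current vector is replaced by one with the same
saturation (possibly itself), then a division step is performed. -/
def WeakSatDivStep (W : Matrix (Fin m) (Fin n) ℤ) (δ : Fin r → Fin m → ℤ)
    (σ : Term (Fin n) r → Term (Fin n) r → Prop) (G : Multiset (Vec (Fin m ⊕ Fin n) r K))
    (V V'' : Vec (Fin m ⊕ Fin n) r K) : Prop :=
  ∃ V', SameSat W δ V V' ∧ DivStep (extend W δ σ) G V' V''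

/-- `R` is a weak saturating remainder of `V` with respect to `G`. -/
def IsWeakSatRem (W : Matrix (Fin m) (Fin n) ℤ) (δ : Fin r → Fin m → ℤ)
    (σ : Term (Fin n) r → Term (Fin n) r → Prop) (G : Multiset (Vec (Fin m ⊕ Fin n) r K))
    (V R : Vec (Fin m ⊕ Fin n) r K) : Prop :=
  ∃ V', ReflTransGen (WeakSatDivStep W δ σ G) V V' ∧ SameSat W δ V' R ∧
    HeadIrreducible (extend W δ σ) G R

/-- `R` is a saturating remainder of `V` with respect to `G`. -/
def IsSatRem (W : Matrix (Fin m) (Fin n) ℤ) (δ : Fin r → Fin m → ℤ)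
    (σ : Term (Fin n) r → Term (Fin n) r → Prop) (G : Multiset (Vec (Fin m ⊕ Fin n) r K))
    (V R : Vec (Fin m ⊕ Fin n) r K) : Prop :=
  ∃ R', IsRem (extend W δ σ) G V R' ∧ R = sat W δ R'

end Homogenization

/-! ### Buchberger's Algorithm with an arbitrary notion of remainder -/

section Algorithm

variable {ι : Type} {r : ℕ} {K : Type*} [Field K]

/-- The data `Gens`, `Pairs`, `𝒢` of Buchberger's Algorithm. -/
structure State (ι : Type) (r : ℕ) (K : Type*) [Field K] where
  gens : Multiset (Vec ι r K)
  pairs : Multiset (Vec ι r K × Vec ι r K)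
  basis : Multiset (Vec ι r K)

/-- Initialization with the tuple `U` of generators. -/
def State.init {s : ℕ} (U : Fin s → Vec ι r K) : State ι r K :=
  ⟨Finset.univ.val.map U, 0, 0⟩

/-- The loop ends when there are no generators and no pairs left. -/
def State.IsFinal (S : State ι r K) : Prop := S.gens = 0 ∧ S.pairs = 0

/-- The vectors in `𝒢`; in a final state, the output. -/
def State.output (S : State ι r K) : Set (Vec ι r K) := {v | v ∈ S.basis}

/-- The choice of `w`: it is removed from `Gens`, or a pair is removed from `Pairs` and `w` is its
S-vector. -/
inductive Select (lt : Term ι r → Term ι r → Prop) :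
    State ι r K → Vec ι r K → State ι r K → Prop
  | gen (w : Vec ι r K) (gens : Multiset (Vec ι r K))
      (pairs : Multiset (Vec ι r K × Vec ι r K)) (G : Multiset (Vec ι r K)) :
      Select lt ⟨w ::ₘ gens, pairs, G⟩ w ⟨gens, pairs, G⟩
  | pair (u v w : Vec ι r K) (gens : Multiset (Vec ι r K))
      (pairs : Multiset (Vec ι r K × Vec ι r K)) (G : Multiset (Vec ι r K))
      (h : IsSVector lt u v w) :
      Select lt ⟨gens, (u, v) ::ₘ pairs, G⟩ w ⟨gens, pairs, G⟩

open Classical in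
/-- A remainder `v ≠ 0` is added to `𝒢`, and to `Pairs` all the pairs `(v, g)` with `g` in the old
`𝒢` that have an S-vector. -/
noncomputable def State.update (lt : Term ι r → Term ι r → Prop) (S : State ι r K)
    (v : Vec ι r K) : State ι r K :=
  if v = 0 then S else
    ⟨S.gens, S.pairs + (S.basis.filter fun g => ∃ w, IsSVector lt v g w).map fun g => (v, g),
      v ::ₘ S.basis⟩

/-- One pass through the main loop, where `Rem G w v` says that `v` is an admissible remainder of
`w` by `G`. -/
def LoopStep (lt : Term ι r → Term ι r → Prop)
    (Rem : Multiset (Vec ι r K) → Vec ι r K → Vec ι r K → Prop) (S S' : State ι r K) : Prop :=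
  ∃ w S₁ v, Select lt S w S₁ ∧ Rem S.basis w v ∧ S' = S₁.update lt v

/-- There is no infinite sequence of steps starting from `x`. -/
def NoInfiniteRun {α : Type*} (step : α → α → Prop) (x : α) : Prop :=
  ¬ ∃ f : ℕ → α, f 0 = x ∧ ∀ k, step (f k) (f (k + 1))

/-- Buchberger's Algorithm with division steps `div` and remainders `Rem`, applied to `U`,
computes an output with the property `Spec`, whatever choices are made: every division and the
main loop terminate, the loop gets stuck only in final states, and then the output satisfies
`Spec`. -/
structure Computes (lt : Term ι r → Term ι r → Prop)
    (div Rem : Multiset (Vec ι r K) → Vec ι r K → Vec ι r K → Prop) {s : ℕ}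
    (U : Fin s → Vec ι r K) (Spec : Set (Vec ι r K) → Prop) : Prop where
  division_terminates : ∀ S, ReflTransGen (LoopStep lt Rem) (State.init U) S →
    ∀ w S₁, Select lt S w S₁ → NoInfiniteRun (div S.basis) w
  loop_terminates : NoInfiniteRun (LoopStep lt Rem) (State.init U)
  progress : ∀ S, ReflTransGen (LoopStep lt Rem) (State.init U) S →
    ¬ S.IsFinal → ∃ S', LoopStep lt Rem S S'
  correct : ∀ S, ReflTransGen (LoopStep lt Rem) (State.init U) S →
    S.IsFinal → Spec S.output

end Algorithm

section Variants

variable {m n r : ℕ} {K : Type*} [Field K]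

/-- Every Weak Self-Saturating Buchberger's Algorithm applied to `U` computes an output with the
property `Spec`. -/
def WeakSelfSatBAComputes (W : Matrix (Fin m) (Fin n) ℤ) (δ : Fin r → Fin m → ℤ)
    (σ : Term (Fin n) r → Term (Fin n) r → Prop) {s : ℕ}
    (U : Fin s → Vec (Fin m ⊕ Fin n) r K) (Spec : Set (Vec (Fin m ⊕ Fin n) r K) → Prop) : Prop :=
  Computes (extend W δ σ) (WeakSatDivStep W δ σ) (IsWeakSatRem W δ σ) U Spec

/-- The Self-Saturating Buchberger's Algorithm applied to `U` computes an output with the property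
`Spec`. -/
def SelfSatBAComputes (W : Matrix (Fin m) (Fin n) ℤ) (δ : Fin r → Fin m → ℤ)
    (σ : Term (Fin n) r → Term (Fin n) r → Prop) {s : ℕ}
    (U : Fin s → Vec (Fin m ⊕ Fin n) r K) (Spec : Set (Vec (Fin m ⊕ Fin n) r K) → Prop) : Prop :=
  Computes (extend W δ σ) (DivStep (extend W δ σ)) (IsSatRem W δ σ) U Spec

end Variants

end SatBA

/-! Everything rests on one graded form of Buchberger's criterion,
`isGroebnerBasis_of_sPairReduces`: a finite set of non-zero homogeneous vectors is a Gröbner basis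
of its span as soon as every S-vector is a combination of multiples `X^c g` whose leading terms lie
below the lcm. Only the terms of each single degree have to be well-ordered. The criterion is used
twice: for `σ` with a constant degree, and for `extend W δ σ` with the degree `degWbar`.

Within one degree, the extended ordering is `σ` applied to the dehomogenized terms, and no two terms
of a homogeneous vector merge under `deh`. Hence S-vectors and divisions of homogeneous vectors
dehomogenize to S-vectors and divisions for `σ`, while replacing a vector by another with the same
saturation leaves its dehomogenization unchanged. Every weak saturating remainder thus gives, after
`deh`, a division chain in the ordinary sense. This yields the lcm representations for the
dehomogenized output, and shows that this output spans `N^deh`.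

For SelfSatBA the same bookkeeping is also done without dehomogenizing. A homogeneous remainder `R`
is a power product times `R^sat`, so a division ending in `R` still gives an lcm representation
using `R^sat`. The output is therefore a Gröbner basis of its own span; that module may differ from
`N`, but it has the same dehomogenization and hence the same saturation.

The main loop stops by Dickson's lemma applied to the leading terms of the new remainders, whatever
the ordering. Divisions stop because a module term ordering is well-founded, again by Dickson. The
notions `IsRemainderFor` and `TransfersDivision` let both algorithms share one analysis of the loop.
-/

namespace SatBA

open MvPolynomial Relation

/-! ### Coefficients and multiplication by monomials -/

section TermBasics

variable {ι : Type} {r : ℕ} {K : Type*} [Field K]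

/-- The term `X^c T`. -/
noncomputable def mulTerm (c : ι →₀ ℕ) (T : Term ι r) : Term ι r := (T.1, c + T.2)

theorem mulTerm_add (c d : ι →₀ ℕ) (T : Term ι r) :
    mulTerm (c + d) T = mulTerm c (mulTerm d T) := by
  simp [mulTerm, add_assoc]

@[simp] theorem tcoeff_zero (T : Term ι r) : tcoeff (0 : Vec ι r K) T = 0 := by
  simp [tcoeff]

@[simp] theorem tcoeff_add (u v : Vec ι r K) (T : Term ι r) :
    tcoeff (u + v) T = tcoeff u T + tcoeff v T := by
  simp [tcoeff]

@[simp] theorem tcoeff_sub (u v : Vec ι r K) (T : Term ι r) :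
    tcoeff (u - v) T = tcoeff u T - tcoeff v T := by
  simp [tcoeff]

@[simp] theorem tcoeff_smul (k : K) (v : Vec ι r K) (T : Term ι r) :
    tcoeff (k • v) T = k * tcoeff v T := by
  simp [tcoeff]

theorem vec_ext {u v : Vec ι r K} (h : ∀ T, tcoeff u T = tcoeff v T) : u = v := by
  funext i
  ext a
  exact h (i, a)

theorem exists_tcoeff_ne_zero {v : Vec ι r K} (hv : v ≠ 0) : ∃ T, tcoeff v T ≠ 0 := by
  by_contra! h
  exact hv (vec_ext fun T => by simp [h T])

@[simp] theorem tcoeff_monomial_smul (c : ι →₀ ℕ) (k : K) (v : Vec ι r K) (T : Term ι r) :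
    tcoeff (monomial c k • v) (mulTerm c T) = k * tcoeff v T := by
  simp [tcoeff, mulTerm]

theorem exists_of_tcoeff_monomial_smul_ne_zero {c : ι →₀ ℕ} {k : K} {v : Vec ι r K}
    {T : Term ι r} (h : tcoeff (monomial c k • v) T ≠ 0) :
    ∃ S, T = mulTerm c S ∧ tcoeff v S ≠ 0 := by
  have h' := h
  simp only [tcoeff, Pi.smul_apply, smul_eq_mul, coeff_monomial_mul'] at h'
  split_ifs at h' with hc
  · refine ⟨(T.1, T.2 - c), ?_, right_ne_zero_of_mul h'⟩
    simp [mulTerm, add_tsub_cancel_of_le hc]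
  · exact absurd rfl h'

theorem finite_terms (v : Vec ι r K) : {T | tcoeff v T ≠ 0}.Finite := by
  refine (Set.finite_iUnion fun i : Fin r =>
    ((v i).support.finite_toSet.image (Prod.mk i))).subset ?_
  rintro ⟨i, a⟩ h
  exact Set.mem_iUnion.2 ⟨i, a, by simpa [tcoeff] using h, rfl⟩

theorem monomial_smul_eq_smul (c : ι →₀ ℕ) (k : K) (v : Vec ι r K) :
    monomial c k • v = k • ((monomial c 1 : MvPolynomial ι K) • v) := by
  funext i
  simp [← smul_mul_assoc, smul_monomial]

theorem monomial_smul_smul (c d : ι →₀ ℕ) (k l : K) (v : Vec ι r K) :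
    (monomial c k : MvPolynomial ι K) • (monomial d l : MvPolynomial ι K) • v
      = monomial (c + d) (k * l) • v := by
  rw [smul_smul, monomial_mul]

theorem monomial_smul_termVec (c : ι →₀ ℕ) (T : Term ι r) :
    (monomial c (1 : K) : MvPolynomial ι K) • termVec K T = termVec K (mulTerm c T) := by
  funext j
  by_cases hj : j = T.1
  · subst hj
    simp [termVec, mulTerm, monomial_mul]
  · simp [termVec, mulTerm, hj]

end TermBasics

/-! ### Existence and uniqueness of leading terms -/

section LeadingTerms

variable {ι : Type} {r : ℕ} {K : Type*} [Field K] {lt : Term ι r → Term ι r → Prop}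

theorem exists_isMax_of_finite {α : Type*} {lt : α → α → Prop} (h : IsStrictTotalOrder α lt)
    {s : Set α} (hs : s.Finite) (hne : s.Nonempty) : ∃ T ∈ s, ∀ T' ∈ s, T' = T ∨ lt T' T := by
  induction s, hs using Set.Finite.induction_on with
  | empty => exact absurd hne Set.not_nonempty_empty
  | @insert a s _ _ ih =>
    rcases s.eq_empty_or_nonempty with rfl | hs
    · exact ⟨a, by simp, by simp⟩
    · obtain ⟨T, hT, hmax⟩ := ih hs
      rcases trichotomous_of lt a T with hlt | rfl | hlt
      · refine ⟨T, Set.mem_insert_of_mem _ hT, ?_⟩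
        rintro T' (rfl | h')
        exacts [Or.inr hlt, hmax T' h']
      · refine ⟨a, Set.mem_insert _ _, ?_⟩
        rintro T' (rfl | h')
        exacts [Or.inl rfl, hmax T' h']
      · refine ⟨a, Set.mem_insert _ _, ?_⟩
        rintro T' (rfl | h')
        · exact Or.inl rfl
        · rcases hmax T' h' with rfl | h''
          exacts [Or.inr hlt, Or.inr (trans_of lt h'' hlt)]

theorem exists_isLT (h : IsStrictTotalOrder _ lt) {v : Vec ι r K} (hv : v ≠ 0) :
    ∃ T, IsLT lt v T :=
  exists_isMax_of_finite h (finite_terms v) (exists_tcoeff_ne_zero hv)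

theorem IsLT.ne_zero {v : Vec ι r K} {T : Term ι r} (h : IsLT lt v T) : v ≠ 0 := by
  rintro rfl
  exact h.1 (by simp)

theorem IsLT.unique (h : IsStrictTotalOrder _ lt) {v : Vec ι r K} {S T : Term ι r}
    (hS : IsLT lt v S) (hT : IsLT lt v T) : S = T := by
  rcases hS.2 T hT.1 with e | l
  · exact e.symm
  · rcases hT.2 S hS.1 with e | l'
    · exact e
    · exact absurd (trans_of lt l l') (irrefl_of lt _)

end LeadingTerms

/-! ### Graded orders, lcm representations and S-vectors -/

section Grading

variable {ι : Type} {r : ℕ} {K : Type*} [Field K] {D : Type*}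
  {lt : Term ι r → Term ι r → Prop} {deg : Term ι r → D}

/-- A strict total order and a grading on terms, both compatible with multiplication by power
products. -/
structure IsCompatible (lt : Term ι r → Term ι r → Prop) (deg : Term ι r → D) : Prop where
  total : IsStrictTotalOrder (Term ι r) lt
  mul : ∀ c S T, lt S T → lt (mulTerm c S) (mulTerm c T)
  deg_mul : ∀ c S T, deg S = deg T → deg (mulTerm c S) = deg (mulTerm c T)

/-- All terms of `v` have the same degree. -/
def SameDeg (deg : Term ι r → D) (v : Vec ι r K) : Prop :=
  ∀ S T, tcoeff v S ≠ 0 → tcoeff v T ≠ 0 → deg S = deg T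

/-- All terms of `v` are smaller than `T` and of the same degree as `T`. -/
def TermsBelow (lt : Term ι r → Term ι r → Prop) (deg : Term ι r → D) (v : Vec ι r K)
    (T : Term ι r) : Prop :=
  ∀ S, tcoeff v S ≠ 0 → lt S T ∧ deg S = deg T

/-- The `K`-span of the multiples `X^c g` with `g ∈ G` whose leading terms are smaller than `T` and
of the same degree as `T`. -/
noncomputable def stdSpan (lt : Term ι r → Term ι r → Prop) (deg : Term ι r → D) (G : Set (Vec ι r K))
    (T : Term ι r) : Submodule K (Vec ι r K) :=
  Submodule.span K {x | ∃ g ∈ G, ∃ c S, IsLT lt g S ∧ lt (mulTerm c S) T ∧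
    deg (mulTerm c S) = deg T ∧ x = (monomial c 1 : MvPolynomial ι K) • g}

/-- The S-vector of `u` and `v` with leading terms `S` and `T`. -/
noncomputable def sVec (u v : Vec ι r K) (S T : Term ι r) : Vec ι r K :=
  monomial ((S.2 ⊔ T.2) - S.2) (tcoeff u S)⁻¹ • u - monomial ((S.2 ⊔ T.2) - T.2) (tcoeff v T)⁻¹ • v

/-- The S-vector of `u` and `v`, if there is one, has an lcm representation in terms of `G`. -/
def SPairReduces (lt : Term ι r → Term ι r → Prop) (deg : Term ι r → D) (G : Set (Vec ι r K))
    (u v : Vec ι r K) : Prop :=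
  ∀ i a b, IsLT lt u (i, a) → IsLT lt v (i, b) →
    sVec u v (i, a) (i, b) ∈ stdSpan lt deg G (i, a ⊔ b)

theorem IsLT.monomial_smul (h : IsCompatible lt deg) {v : Vec ι r K} {T : Term ι r}
    (hv : IsLT lt v T) (c : ι →₀ ℕ) {k : K} (hk : k ≠ 0) :
    IsLT lt (monomial c k • v) (mulTerm c T) := by
  refine ⟨by simp [hk, hv.1], fun T' hT' => ?_⟩
  obtain ⟨S, rfl, hS⟩ := exists_of_tcoeff_monomial_smul_ne_zero hT'
  rcases hv.2 S hS with rfl | hlt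
  exacts [Or.inl rfl, Or.inr (h.mul c _ _ hlt)]

theorem SameDeg.monomial_smul (h : IsCompatible lt deg) {v : Vec ι r K} (hv : SameDeg deg v)
    (c : ι →₀ ℕ) (k : K) : SameDeg deg (monomial c k • v) := by
  intro S T hS hT
  obtain ⟨S, rfl, hS'⟩ := exists_of_tcoeff_monomial_smul_ne_zero hS
  obtain ⟨T, rfl, hT'⟩ := exists_of_tcoeff_monomial_smul_ne_zero hT
  exact h.deg_mul c _ _ (hv _ _ hS' hT')

theorem stdSpan_mono {G G' : Set (Vec ι r K)} (hG : G ⊆ G') (T : Term ι r) :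
    stdSpan lt deg G T ≤ stdSpan lt deg G' T := by
  refine Submodule.span_mono ?_
  rintro x ⟨g, hg, hx⟩
  exact ⟨g, hG hg, hx⟩

theorem SPairReduces.mono {G G' : Set (Vec ι r K)} (hG : G ⊆ G') {u v : Vec ι r K}
    (h : SPairReduces lt deg G u v) : SPairReduces lt deg G' u v :=
  fun i a b hu hv => stdSpan_mono hG _ (h i a b hu hv)

theorem sVec_swap (u v : Vec ι r K) (S T : Term ι r) : sVec v u T S = -sVec u v S T := by
  simp [sVec, sup_comm]

theorem SPairReduces.symm {G : Set (Vec ι r K)} {u v : Vec ι r K}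
    (h : SPairReduces lt deg G u v) : SPairReduces lt deg G v u := by
  intro i a b hv hu
  rw [sVec_swap, sup_comm]
  exact Submodule.neg_mem _ (h i b a hu hv)

theorem SPairReduces.refl (h : IsStrictTotalOrder _ lt) (G : Set (Vec ι r K)) (u : Vec ι r K) :
    SPairReduces lt deg G u u := by
  intro i a b hu hv
  rw [hu.unique h hv]
  simp [sVec]

theorem monomial_smul_mem_stdSpan (h : IsCompatible lt deg) {G : Set (Vec ι r K)} {x : Vec ι r K}
    {T : Term ι r} (hx : x ∈ stdSpan lt deg G T) (c : ι →₀ ℕ) :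
    (monomial c 1 : MvPolynomial ι K) • x ∈ stdSpan lt deg G (mulTerm c T) := by
  induction hx using Submodule.span_induction with
  | mem x hx =>
    obtain ⟨g, hg, d, S, hS, hlt, hdeg, rfl⟩ := hx
    refine Submodule.subset_span ⟨g, hg, c + d, S, hS, ?_, ?_, ?_⟩
    · rw [mulTerm_add]; exact h.mul c _ _ hlt
    · rw [mulTerm_add]; exact h.deg_mul c _ _ hdeg
    · rw [monomial_smul_smul, one_mul]
  | zero => simp
  | add x y _ _ hx hy => rw [smul_add]; exact add_mem hx hy
  | smul k x _ hx => rw [smul_comm]; exact Submodule.smul_mem _ k hx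

theorem TermsBelow.add {u v : Vec ι r K} {T : Term ι r} (hu : TermsBelow lt deg u T)
    (hv : TermsBelow lt deg v T) : TermsBelow lt deg (u + v) T := by
  intro S hS
  by_cases h : tcoeff u S = 0
  · exact hv S (by simpa [h] using hS)
  · exact hu S h

theorem TermsBelow.smul {v : Vec ι r K} {T : Term ι r} (hv : TermsBelow lt deg v T) (k : K) :
    TermsBelow lt deg (k • v) T :=
  fun S hS => hv S (right_ne_zero_of_mul (by simpa only [tcoeff_smul] using hS))

theorem TermsBelow.sub {u v : Vec ι r K} {T : Term ι r} (hu : TermsBelow lt deg u T)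
    (hv : TermsBelow lt deg v T) : TermsBelow lt deg (u - v) T := by
  have := hu.add (hv.smul (-1))
  rwa [neg_one_smul, ← sub_eq_add_neg] at this

theorem termsBelow_of_isLT (h : IsCompatible lt deg) {v : Vec ι r K} {S T : Term ι r}
    (hv : SameDeg deg v) (hS : IsLT lt v S) (hlt : lt S T) (hdeg : deg S = deg T) :
    TermsBelow lt deg v T := by
  have := h.total
  intro S' hS'
  refine ⟨?_, (hv _ _ hS' hS.1).trans hdeg⟩
  rcases hS.2 S' hS' with rfl | hlt'
  exacts [hlt, trans_of lt hlt' hlt]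

theorem termsBelow_of_mem_stdSpan (h : IsCompatible lt deg) {G : Set (Vec ι r K)}
    (hG : ∀ g ∈ G, SameDeg deg g) {x : Vec ι r K} {T : Term ι r}
    (hx : x ∈ stdSpan lt deg G T) : TermsBelow lt deg x T := by
  induction hx using Submodule.span_induction with
  | mem x hx =>
    obtain ⟨g, hg, c, S, hS, hlt, hdeg, rfl⟩ := hx
    exact termsBelow_of_isLT h ((hG g hg).monomial_smul h c 1)
      (hS.monomial_smul h c one_ne_zero) hlt hdeg
  | zero => intro S hS; simp at hS
  | add x y _ _ hx hy => exact hx.add hy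
  | smul k x _ hx => exact hx.smul k

/-- Both multiples are normalized to have leading term the lcm with coefficient 1, so this term
cancels; all other terms are smaller and share its degree. -/
theorem termsBelow_sVec (h : IsCompatible lt deg) {u v : Vec ι r K} (hu : SameDeg deg u)
    (hv : SameDeg deg v) {i : Fin r} {a b : ι →₀ ℕ} (ha : IsLT lt u (i, a))
    (hb : IsLT lt v (i, b)) : TermsBelow lt deg (sVec u v (i, a) (i, b)) (i, a ⊔ b) := by
  have key : ∀ {w : Vec ι r K} (_ : SameDeg deg w) {c : ι →₀ ℕ} (_ : IsLT lt w (i, c))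
      (_ : c ≤ a ⊔ b), IsLT lt (monomial ((a ⊔ b) - c) (tcoeff w (i, c))⁻¹ • w) (i, a ⊔ b) ∧
      SameDeg deg (monomial ((a ⊔ b) - c) (tcoeff w (i, c))⁻¹ • w) ∧
      tcoeff (monomial ((a ⊔ b) - c) (tcoeff w (i, c))⁻¹ • w) (i, a ⊔ b) = 1 := by
    intro w hw c hc hle
    have e : mulTerm ((a ⊔ b) - c) (i, c) = (i, a ⊔ b) := by
      simp [mulTerm, tsub_add_cancel_of_le hle]
    have h1 := hc.monomial_smul h ((a ⊔ b) - c) (inv_ne_zero hc.1)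
    have h2 := tcoeff_monomial_smul ((a ⊔ b) - c) (tcoeff w (i, c))⁻¹ w (i, c)
    rw [e] at h1 h2
    exact ⟨h1, hw.monomial_smul h _ _, by rw [h2, inv_mul_cancel₀ hc.1]⟩
  obtain ⟨u1, u2, u3⟩ := key hu ha le_sup_left
  obtain ⟨v1, v2, v3⟩ := key hv hb le_sup_right
  intro S hS
  have hne : S ≠ (i, a ⊔ b) := by
    rintro rfl
    exact hS (by rw [sVec, tcoeff_sub]; simp only; rw [u3, v3, sub_self])
  by_cases hS' : tcoeff (monomial ((a ⊔ b) - a) (tcoeff u (i, a))⁻¹ • u) S = 0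
  · have hS'' : tcoeff (monomial ((a ⊔ b) - b) (tcoeff v (i, b))⁻¹ • v) S ≠ 0 := by
      intro h0
      exact hS (by rw [sVec, tcoeff_sub]; simp only; rw [hS', h0, sub_self])
    exact ⟨(v1.2 S hS'').resolve_left hne, v2 _ _ hS'' v1.1⟩
  · exact ⟨(u1.2 S hS').resolve_left hne, u2 _ _ hS' u1.1⟩

end Grading

/-! ### Division chains and their termination -/

section Division

variable {ι : Type} {r : ℕ} {K : Type*} [Field K] {D : Type*}
  {lt : Term ι r → Term ι r → Prop} {deg : Term ι r → D}

theorem DivStep.sameDeg (h : IsCompatible lt deg) {G : Multiset (Vec ι r K)}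
    (hG : ∀ g ∈ G, SameDeg deg g) {v v' : Vec ι r K} (hv : SameDeg deg v)
    (hs : DivStep lt G v v') : SameDeg deg v' := by
  obtain ⟨g, hg, i, b, c, hb, hne, rfl⟩ := hs
  have hX := (hG g hg).monomial_smul h c (tcoeff v (i, c + b) / tcoeff g (i, b))
  have hT : ∀ S, tcoeff (v - monomial c (tcoeff v (i, c + b) / tcoeff g (i, b)) • g) S ≠ 0 →
      deg S = deg (i, c + b) := by
    intro S hS
    by_cases hS' : tcoeff v S = 0
    · refine hX _ _ ?_ ?_
      · intro h0
        rw [tcoeff_sub, hS', h0, sub_zero] at hS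
        exact hS rfl
      · exact (hb.monomial_smul h c (div_ne_zero hne hb.1)).1
    · exact hv _ _ hS' hne
  intro S T hS hS'
  rw [hT S hS, hT T hS']

theorem sameDeg_of_reflTransGen_divStep (h : IsCompatible lt deg) {G : Multiset (Vec ι r K)}
    (hG : ∀ g ∈ G, SameDeg deg g) {v v' : Vec ι r K} (hv : SameDeg deg v)
    (hs : ReflTransGen (DivStep lt G) v v') : SameDeg deg v' := by
  induction hs with
  | refl => exact hv
  | tail _ hs ih => exact hs.sameDeg h hG ih

/-- A chain of divisions that starts below `T` yields a representation below `T`. -/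
theorem sub_mem_stdSpan_of_reflTransGen_divStep (h : IsCompatible lt deg)
    {G : Multiset (Vec ι r K)} (hG : ∀ g ∈ G, SameDeg deg g) {w R : Vec ι r K} {T : Term ι r}
    (hw : TermsBelow lt deg w T) (hs : ReflTransGen (DivStep lt G) w R) :
    w - R ∈ stdSpan lt deg {g | g ∈ G} T ∧ TermsBelow lt deg R T := by
  induction hs with
  | refl => exact ⟨by simp, hw⟩
  | @tail v v' _ hs ih =>
    obtain ⟨g, hg, i, b, c, hb, hne, rfl⟩ := hs
    have hmem : monomial c (tcoeff v (i, c + b) / tcoeff g (i, b)) • g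
        ∈ stdSpan lt deg {g | g ∈ G} T := by
      rw [monomial_smul_eq_smul]
      refine Submodule.smul_mem _ _ (Submodule.subset_span ⟨g, hg, c, (i, b), hb, ?_, ?_, rfl⟩)
      exacts [(ih.2 _ hne).1, (ih.2 _ hne).2]
    refine ⟨?_, ih.2.sub (termsBelow_of_mem_stdSpan h hG hmem)⟩
    rw [sub_sub_eq_add_sub, add_sub_right_comm]
    exact add_mem ih.1 hmem

/-- Divisions of homogeneous vectors terminate if the terms of each degree are well-ordered. -/
theorem noInfiniteRun_divStep (h : IsCompatible lt deg)
    (hwf : WellFounded fun S T => lt S T ∧ deg S = deg T) {G : Multiset (Vec ι r K)}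
    (hG : ∀ g ∈ G, SameDeg deg g) {v : Vec ι r K} (hv : SameDeg deg v) :
    NoInfiniteRun (DivStep lt G) v := by
  rintro ⟨f, rfl, hf⟩
  have hdeg : ∀ k, SameDeg deg (f k) := by
    intro k
    induction k with
    | zero => exact hv
    | succ k ih => exact (hf k).sameDeg h hG ih
  -- A step may eliminate a term that is not the leading one, so leading terms need not decrease.
  -- Vectors are instead compared lexicographically as coefficient functions: at some term a
  -- non-zero coefficient becomes 0 (`s`), while only smaller terms of the same degree may change
  -- (the complement of `rel`).
  let rel : Term ι r → Term ι r → Prop := fun S T => ¬ (lt S T ∧ deg S = deg T) ∧ S ≠ T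
  let s : K → K → Prop := fun a b => a = 0 ∧ b ≠ 0
  have hs : WellFounded s := by
    have h0 : ∀ a : K, a = 0 → Acc s a := fun a ha => Acc.intro _ fun b hb => absurd ha hb.2
    exact ⟨fun a => Acc.intro _ fun b hb => h0 b hb.1⟩
  have hrel : WellFounded (relᶜ ⊓ (· ≠ ·)) := by
    refine Subrelation.wf ?_ hwf
    rintro S T ⟨h1, h2⟩
    by_contra h3
    exact h1 ⟨h3, h2⟩
  have hlex := Finsupp.Lex.wellFounded (r := rel) (s := s) (fun n hn => hn.2 rfl) hs hrel
  let φ : Vec ι r K → Term ι r →₀ K := fun v => Finsupp.ofSupportFinite (tcoeff v) (finite_terms v)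
  have hφ : ∀ v T, φ v T = tcoeff v T := fun v T => rfl
  refine (wellFounded_iff_isEmpty_descending_chain.1 hlex).elim ⟨fun k => φ (f k), fun k => ?_⟩
  obtain ⟨g, hg, i, b, c, hb, hne, hk⟩ := hf k
  set α := tcoeff (f k) (i, c + b) / tcoeff g (i, b) with hα
  have hX : IsLT lt (monomial c α • g) (i, c + b) := hb.monomial_smul h c (div_ne_zero hne hb.1)
  have hXc : tcoeff (monomial c α • g) (i, c + b) = tcoeff (f k) (i, c + b) := by
    refine (tcoeff_monomial_smul c α g (i, b)).trans ?_
    rw [hα, div_mul_cancel₀ _ hb.1]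
  refine ⟨(i, c + b), fun S hS => ?_, ?_, ?_⟩
  · change tcoeff _ S = tcoeff _ S
    rw [hk, tcoeff_sub, sub_eq_self]
    by_contra hS'
    exact hS.1 ⟨(hX.2 S hS').resolve_left hS.2,
      ((hG g hg).monomial_smul h c α) _ _ hS' hX.1⟩
  · change tcoeff _ _ = 0
    rw [hk, tcoeff_sub, hXc, sub_self]
  · exact hne

theorem exists_reflTransGen_of_noInfiniteRun {α : Type*} {step : α → α → Prop} {x : α}
    (h : NoInfiniteRun step x) : ∃ y, ReflTransGen step x y ∧ ∀ z, ¬ step y z := by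
  by_contra! hcon
  choose! next hnext using hcon
  let f : ℕ → α := fun k => next^[k] x
  have hf : ∀ k, ReflTransGen step x (f k) := by
    intro k
    induction k with
    | zero => exact .refl
    | succ k ih =>
      change ReflTransGen step x (next^[k + 1] x)
      rw [Function.iterate_succ_apply']
      exact ih.tail (hnext _ ih)
  refine h ⟨f, rfl, fun k => ?_⟩
  change step _ (next^[k + 1] x)
  rw [Function.iterate_succ_apply']
  exact hnext _ (hf k)

/-- A divisible leading term would itself allow a division step, so exhausting division steps
produces a remainder. -/
theorem headIrreducible_of_forall_not_divStep {G : Multiset (Vec ι r K)} {v : Vec ι r K}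
    (h : ∀ v', ¬ DivStep lt G v v') : HeadIrreducible lt G v := by
  intro g hg i a b ha hb hle
  refine h _ ⟨g, hg, i, b, a - b, hb, ?_, rfl⟩
  rw [tsub_add_cancel_of_le hle]
  exact ha.1

end Division

/-! ### Buchberger's criterion -/

section Criterion

variable {ι : Type} {r : ℕ} {K : Type*} [Field K] {D : Type*}
  {lt : Term ι r → Term ι r → Prop} {deg : Term ι r → D}

theorem mem_span_monomial_smul {G : Set (Vec ι r K)} {x : Vec ι r K}
    (hx : x ∈ Submodule.span (MvPolynomial ι K) G) :
    x ∈ Submodule.span K {y | ∃ g ∈ G, ∃ c, y = (monomial c 1 : MvPolynomial ι K) • g} := by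
  have htop : Submodule.span K (Set.range fun c => (monomial c 1 : MvPolynomial ι K)) = ⊤ := by
    rw [← (basisMonomials ι K).span_eq, coe_basisMonomials]
  rw [← Submodule.restrictScalars_mem K, ← Submodule.span_smul_of_span_eq_top htop] at hx
  refine Submodule.span_mono ?_ hx
  rintro _ ⟨_, ⟨c, rfl⟩, g, hg, rfl⟩
  exact ⟨g, hg, c, rfl⟩

/-- Two multiples of elements of `G` with the same leading term `T` are proportional modulo
`stdSpan G T`. -/
theorem exists_sub_smul_mem_stdSpan (h : IsCompatible lt deg) {G : Set (Vec ι r K)}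
    (hS : ∀ u ∈ G, ∀ v ∈ G, SPairReduces lt deg G u v) {u v : Vec ι r K} (hu : u ∈ G) (hv : v ∈ G)
    {i : Fin r} {a b c d : ι →₀ ℕ} (ha : IsLT lt u (i, a)) (hb : IsLT lt v (i, b))
    (hT : c + a = d + b) :
    ∃ k : K, (monomial c 1 : MvPolynomial ι K) • u - k • ((monomial d 1 : MvPolynomial ι K) • v)
      ∈ stdSpan lt deg G (i, c + a) := by
  have hle : a ⊔ b ≤ c + a := sup_le le_add_self (hT ▸ le_add_self)
  -- The lcm divides the common leading term, with cofactor `X^e`; the required difference is then,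
  -- up to a scalar, `X^e` times the S-vector.
  obtain ⟨e, he⟩ : ∃ e, c + a = e + (a ⊔ b) := ⟨_, (tsub_add_cancel_of_le hle).symm⟩
  have hmem := monomial_smul_mem_stdSpan h (hS u hu v hv i a b ha hb) e
  have e1 : e + (a ⊔ b - a) = c := by
    rw [← add_tsub_assoc_of_le le_sup_left, ← he, add_tsub_cancel_right]
  have e2 : e + (a ⊔ b - b) = d := by
    rw [← add_tsub_assoc_of_le le_sup_right, ← he, hT, add_tsub_cancel_right]
  have e3 : mulTerm e (i, a ⊔ b) = (i, c + a) := by simp [mulTerm, he]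
  rw [e3, sVec, smul_sub, monomial_smul_smul, monomial_smul_smul, e1, e2, one_mul, one_mul,
    monomial_smul_eq_smul c, monomial_smul_eq_smul d] at hmem
  refine ⟨tcoeff u (i, a) * (tcoeff v (i, b))⁻¹, ?_⟩
  have := Submodule.smul_mem _ (tcoeff u (i, a)) hmem
  rwa [smul_sub, smul_smul, smul_smul, mul_inv_cancel₀ ha.1, one_smul] at this

/-- Among the finitely many multiples used to write `x`, take one, `y₀`, with the largest leading
term `T₀`. Modulo `stdSpan` at `T₀` every other multiple is a scalar times `y₀`, so `x = k y₀ + l`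
with `l` below `T₀`. If `k ≠ 0`, then `T₀` is the leading term of `x`; if `k = 0`, then `hP` applies
to `x = l`. The predicate `P` serves both the inductive step ("below `T`") and the start of the
descent (`True`). -/
theorem exists_dvd_of_mem_span (h : IsCompatible lt deg) {G : Set (Vec ι r K)}
    (hG : ∀ g ∈ G, SameDeg deg g) (hS : ∀ u ∈ G, ∀ v ∈ G, SPairReduces lt deg G u v)
    {P : Term ι r → Prop} {d : D}
    (hP : ∀ T, P T → deg T = d → ∀ x ∈ stdSpan lt deg G T, ∀ S, IsLT lt x S →
      ∃ g ∈ G, ∃ c S', IsLT lt g S' ∧ S = mulTerm c S')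
    {x : Vec ι r K} (hx : x ∈ Submodule.span K {y | ∃ g ∈ G, ∃ c S, IsLT lt g S ∧
      P (mulTerm c S) ∧ deg (mulTerm c S) = d ∧ y = (monomial c 1 : MvPolynomial ι K) • g})
    {T : Term ι r} (hT : IsLT lt x T) :
    ∃ g ∈ G, ∃ c S', IsLT lt g S' ∧ T = mulTerm c S' := by
  have := h.total
  obtain ⟨t, ht, hxt⟩ := Submodule.mem_span_finite_of_mem_span hx
  rcases t.eq_empty_or_nonempty with rfl | hne
  · simp only [Finset.coe_empty, Submodule.span_empty, Submodule.mem_bot] at hxt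
    exact absurd hxt hT.ne_zero
  have ht' : ∀ y ∈ t, ∃ T, IsLT lt y T := by
    intro y hy
    obtain ⟨g, -, c, S, hg, -, -, rfl⟩ := ht hy
    exact ⟨_, hg.monomial_smul h c one_ne_zero⟩
  have : Nonempty (Term ι r) := ⟨T⟩
  choose! L hL using ht'
  obtain ⟨_, ⟨y₀, hy₀, rfl⟩, hmax⟩ := exists_isMax_of_finite h.total
    (t.finite_toSet.image L) (Set.Nonempty.image L hne)
  obtain ⟨g₀, hg₀, c₀, S₀, hS₀, hP₀, hd₀, e₀⟩ := ht hy₀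
  have hL₀ : L y₀ = mulTerm c₀ S₀ :=
    (hL y₀ hy₀).unique h.total (e₀ ▸ hS₀.monomial_smul h c₀ one_ne_zero)
  have hle : Submodule.span K (t : Set (Vec ι r K)) ≤
      Submodule.span K {y₀} ⊔ stdSpan lt deg G (mulTerm c₀ S₀) := by
    refine Submodule.span_le.2 fun y hy => ?_
    obtain ⟨g, hg, c, S, hgS, -, hd, rfl⟩ := ht hy
    have hLy := (hL _ hy).unique h.total (hgS.monomial_smul h c one_ne_zero)
    rcases hmax _ ⟨_, hy, rfl⟩ with heq | hlt
    · rw [hLy, hL₀] at heq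
      have h1 : (mulTerm c S).1 = (mulTerm c₀ S₀).1 := congrArg Prod.fst heq
      have h2 : (mulTerm c S).2 = (mulTerm c₀ S₀).2 := congrArg Prod.snd heq
      obtain ⟨i, a⟩ := S
      obtain ⟨j, b⟩ := S₀
      obtain rfl : i = j := h1
      obtain ⟨k, hk⟩ := exists_sub_smul_mem_stdSpan h hS hg hg₀ hgS hS₀ h2
      change _ ∈ stdSpan lt deg G (mulTerm c (i, a)) at hk
      rw [heq, ← e₀] at hk
      have := Submodule.add_mem_sup
        (Submodule.smul_mem _ k (Submodule.mem_span_singleton_self y₀)) hk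
      rwa [add_sub_cancel] at this
    · rw [hLy, hL₀] at hlt
      exact Submodule.mem_sup_right
        (Submodule.subset_span ⟨g, hg, c, S, hgS, hlt, hd.trans hd₀.symm, rfl⟩)
  obtain ⟨y, hy, l, hl, rfl⟩ := Submodule.mem_sup.1 (hle hxt)
  obtain ⟨k, rfl⟩ := Submodule.mem_span_singleton.1 hy
  by_cases hk : k = 0
  · subst hk
    rw [zero_smul, zero_add] at hT
    exact hP _ hP₀ hd₀ l hl T hT
  · have hl' := termsBelow_of_mem_stdSpan h hG hl
    have hy₀' := hL₀ ▸ hL y₀ hy₀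
    have hl₀ : tcoeff l (mulTerm c₀ S₀) = 0 := by
      by_contra h0
      exact irrefl_of lt _ (hl' _ h0).1
    have hlt : IsLT lt (k • y₀ + l) (mulTerm c₀ S₀) := by
      refine ⟨by simp [hl₀, hk, hy₀'.1], fun S hS => ?_⟩
      by_cases h0 : tcoeff l S = 0
      · refine hy₀'.2 S fun h1 => hS ?_
        simp [h0, h1]
      · exact Or.inr (hl' S h0).1
    exact ⟨g₀, hg₀, c₀, S₀, hS₀, hT.unique h.total hlt⟩

/-- Well-founded descent on the bound `T` inside one degree: the induction hypothesis is exactly the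
assumption `hP` of `exists_dvd_of_mem_span`. -/
theorem exists_dvd_of_mem_stdSpan (h : IsCompatible lt deg)
    (hwf : WellFounded fun S T => lt S T ∧ deg S = deg T) {G : Set (Vec ι r K)}
    (hG : ∀ g ∈ G, SameDeg deg g) (hS : ∀ u ∈ G, ∀ v ∈ G, SPairReduces lt deg G u v)
    (T : Term ι r) : ∀ x ∈ stdSpan lt deg G T, ∀ S, IsLT lt x S →
      ∃ g ∈ G, ∃ c S', IsLT lt g S' ∧ S = mulTerm c S' := by
  induction T using hwf.induction with
  | _ T ih =>
    intro x hx S hxS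
    exact exists_dvd_of_mem_span h hG hS (P := fun S => lt S T)
      (fun T' hT' hd => ih T' ⟨hT', hd⟩) hx hxS

/-- The homogeneous component of degree `d` of a combination of homogeneous vectors. -/
theorem exists_component (h : IsCompatible lt deg) {G : Set (Vec ι r K)}
    (hG : ∀ g ∈ G, SameDeg deg g) {x : Vec ι r K}
    (hx : x ∈ Submodule.span (MvPolynomial ι K) G) (d : D) :
    ∃ y ∈ Submodule.span K {y | ∃ g ∈ G, ∃ c S, IsLT lt g S ∧
      True ∧ deg (mulTerm c S) = d ∧ y = (monomial c 1 : MvPolynomial ι K) • g},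
    (∀ T, tcoeff y T ≠ 0 → deg T = d) ∧ ∀ T, deg T = d → tcoeff y T = tcoeff x T := by
  -- Multiplication by a polynomial does not respect a fixed degree `d`, so the induction runs over
  -- `K`-combinations of monomial multiples, each of which lies in a single degree.
  replace hx := mem_span_monomial_smul hx
  induction hx using Submodule.span_induction with
  | mem x hx =>
    obtain ⟨g, hg, c, rfl⟩ := hx
    by_cases hg0 : g = 0
    · exact ⟨0, zero_mem _, by simp, by simp [hg0]⟩
    obtain ⟨S, hS⟩ := exists_isLT h.total hg0
    have hX := (hG g hg).monomial_smul h c 1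
    have hXS := hS.monomial_smul h c (one_ne_zero (α := K))
    by_cases hd : deg (mulTerm c S) = d
    · exact ⟨_, Submodule.subset_span ⟨g, hg, c, S, hS, trivial, hd, rfl⟩,
        fun T hT => (hX _ _ hT hXS.1).trans hd, fun _ _ => rfl⟩
    · refine ⟨0, zero_mem _, by simp, fun T hT => ?_⟩
      by_contra h0
      exact hd ((hX _ _ hXS.1 (fun h1 => h0 (by rw [h1, tcoeff_zero]))).trans hT)
  | zero => exact ⟨0, zero_mem _, by simp, by simp⟩
  | add x y _ _ hx hy =>
    obtain ⟨x', hx', h1, h2⟩ := hx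
    obtain ⟨y', hy', h3, h4⟩ := hy
    refine ⟨x' + y', add_mem hx' hy', fun T hT => ?_, fun T hT => by simp [h2 T hT, h4 T hT]⟩
    by_cases h0 : tcoeff x' T = 0
    · exact h3 T fun h5 => hT (by simp [h0, h5])
    · exact h1 T h0
  | smul k x _ hx =>
    obtain ⟨x', hx', h1, h2⟩ := hx
    refine ⟨k • x', Submodule.smul_mem _ k hx', fun T hT => h1 T fun h0 => hT ?_,
      fun T hT => by simp [h2 T hT]⟩
    simp [h0]

/-- Buchberger's criterion. -/
theorem isGroebnerBasis_of_sPairReduces (h : IsCompatible lt deg)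
    (hwf : WellFounded fun S T => lt S T ∧ deg S = deg T) {G : Set (Vec ι r K)}
    (hfin : G.Finite) (hne : ∀ g ∈ G, g ≠ 0)
    (hG : ∀ g ∈ G, SameDeg deg g) (hS : ∀ u ∈ G, ∀ v ∈ G, SPairReduces lt deg G u v) :
    IsGroebnerBasis lt (Submodule.span _ G) G where
  finite := hfin
  ne_zero := hne
  span_eq := rfl
  leading := by
    refine le_antisymm (Submodule.span_mono ?_) (Submodule.span_le.2 ?_)
    · rintro t ⟨v, hv, ht⟩
      exact ⟨v, Submodule.subset_span hv, ht⟩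
    · rintro _ ⟨x, hx, T, hT, rfl⟩
      -- An arbitrary `x` need not be homogeneous, but descent is available only within one degree.
      -- The component of `x` in the degree of `T` keeps `T` as its leading term.
      obtain ⟨y, hy, hyd, hyx⟩ := exists_component h hG hx (deg T)
      have hyT : IsLT lt y T := by
        refine ⟨by rw [hyx T rfl]; exact hT.1, fun S hS => hT.2 S ?_⟩
        rwa [← hyx S (hyd S hS)]
      obtain ⟨g, hg, c, S, hgS, rfl⟩ := exists_dvd_of_mem_span h hG hS
        (P := fun _ => True) (fun T _ _ => exists_dvd_of_mem_stdSpan h hwf hG hS T) hy hyT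
      have hmem : termVec K S ∈ leadingModule lt G := by
        unfold leadingModule
        exact Submodule.subset_span ⟨g, hg, S, hgS, rfl⟩
      rw [← monomial_smul_termVec]
      exact Submodule.smul_mem _ _ hmem

end Criterion

/-! ### The main loop: invariants, termination and progress -/

section Loop

variable {ι : Type} {r : ℕ} {K : Type*} [Field K] {lt : Term ι r → Term ι r → Prop}
  {Rem : Multiset (Vec ι r K) → Vec ι r K → Vec ι r K → Prop} {H : Vec ι r K → Prop}

/-- The property `H` of vectors is preserved by S-vectors and remainders, and remainders are
irreducible. -/
structure IsRemainderFor (lt : Term ι r → Term ι r → Prop)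
    (Rem : Multiset (Vec ι r K) → Vec ι r K → Vec ι r K → Prop) (H : Vec ι r K → Prop) :
    Prop where
  sVector : ∀ u v w, H u → H v → IsSVector lt u v w → H w
  rem : ∀ G w v, (∀ g ∈ G, H g) → H w → Rem G w v → H v ∧ HeadIrreducible lt G v

/-- All vectors in the state have the property `H`, and all pairs have S-vectors. -/
structure GoodState (lt : Term ι r → Term ι r → Prop) (H : Vec ι r K → Prop) (S : State ι r K) :
    Prop where
  gens : ∀ v ∈ S.gens, H v
  basis : ∀ v ∈ S.basis, v ≠ 0 ∧ H v
  pairs : ∀ p ∈ S.pairs, H p.1 ∧ H p.2 ∧ ∃ w, IsSVector lt p.1 p.2 w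

theorem Select.basis_eq {S S₁ : State ι r K} {w : Vec ι r K} (h : Select lt S w S₁) :
    S₁.basis = S.basis := by
  cases h <;> rfl

theorem State.update_zero (S : State ι r K) : S.update lt 0 = S := by
  simp [State.update]

theorem State.basis_update (S : State ι r K) {v : Vec ι r K} (hv : v ≠ 0) :
    (S.update lt v).basis = v ::ₘ S.basis := by
  simp [State.update, hv]

theorem State.gens_update (S : State ι r K) (v : Vec ι r K) :
    (S.update lt v).gens = S.gens := by
  by_cases hv : v = 0 <;> simp [State.update, hv]

theorem State.mem_pairs_update (S : State ι r K) {v : Vec ι r K} (hv : v ≠ 0)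
    {p : Vec ι r K × Vec ι r K} : p ∈ (S.update lt v).pairs ↔
      p ∈ S.pairs ∨ (p.1 = v ∧ p.2 ∈ S.basis ∧ ∃ w, IsSVector lt v p.2 w) := by
  obtain ⟨a, b⟩ := p
  simp only [State.update, if_neg hv, Multiset.mem_add, Multiset.mem_map, Multiset.mem_filter,
    Prod.mk.injEq]
  constructor
  · rintro (h | ⟨g, hg, rfl, rfl⟩)
    exacts [Or.inl h, Or.inr ⟨rfl, hg⟩]
  · rintro (h | ⟨rfl, hg⟩)
    exacts [Or.inl h, Or.inr ⟨_, hg, rfl, rfl⟩]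

theorem basis_subset_update (S : State ι r K) (v : Vec ι r K) :
    ∀ g ∈ S.basis, g ∈ (S.update lt v).basis := by
  intro g hg
  by_cases hv : v = 0
  · rwa [hv, S.update_zero]
  · rw [S.basis_update hv]
    exact Multiset.mem_cons_of_mem hg

theorem GoodState.select (hR : IsRemainderFor lt Rem H) {S S₁ : State ι r K} {w : Vec ι r K}
    (hS : GoodState lt H S) (h : Select lt S w S₁) : H w ∧ GoodState lt H S₁ := by
  cases h with
  | gen _ gens pairs G =>
    exact ⟨hS.gens _ (Multiset.mem_cons_self _ _),
      fun v hv => hS.gens _ (Multiset.mem_cons_of_mem hv), hS.basis, hS.pairs⟩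
  | pair u v _ gens pairs G h =>
    have := hS.pairs _ (Multiset.mem_cons_self _ _)
    exact ⟨hR.sVector u v w this.1 this.2.1 h,
      hS.gens, hS.basis, fun p hp => hS.pairs _ (Multiset.mem_cons_of_mem hp)⟩

theorem GoodState.update {S : State ι r K} (hS : GoodState lt H S) {v : Vec ι r K} (hv : H v) :
    GoodState lt H (S.update lt v) := by
  by_cases hv0 : v = 0
  · rwa [hv0, S.update_zero]
  refine ⟨by rw [S.gens_update]; exact hS.gens, ?_, ?_⟩
  · rw [S.basis_update hv0]
    intro u hu
    rcases Multiset.mem_cons.1 hu with rfl | hu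
    exacts [⟨hv0, hv⟩, hS.basis u hu]
  · intro p hp
    rcases (S.mem_pairs_update hv0).1 hp with hp | ⟨h1, h2, h3⟩
    · exact hS.pairs p hp
    · rw [h1]
      exact ⟨hv, (hS.basis _ h2).2, h3⟩

theorem GoodState.step (hR : IsRemainderFor lt Rem H) {S S' : State ι r K}
    (hS : GoodState lt H S) (h : LoopStep lt Rem S S') : GoodState lt H S' := by
  obtain ⟨w, S₁, v, hsel, hrem, rfl⟩ := h
  obtain ⟨hw, hS₁⟩ := hS.select hR hsel
  exact hS₁.update (hR.rem _ _ _ (fun g hg => (hS.basis g hg).2) hw hrem).1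

theorem goodState_init {s : ℕ} {U : Fin s → Vec ι r K} (hU : ∀ i, H (U i)) :
    GoodState lt H (State.init U) := by
  refine ⟨?_, by simp [State.init], by simp [State.init]⟩
  intro v hv
  simp only [State.init, Multiset.mem_map] at hv
  obtain ⟨i, -, rfl⟩ := hv
  exact hU i

theorem goodState_of_reachable (hR : IsRemainderFor lt Rem H) {s : ℕ} {U : Fin s → Vec ι r K}
    (hU : ∀ i, H (U i)) {S : State ι r K}
    (h : ReflTransGen (LoopStep lt Rem) (State.init U) S) : GoodState lt H S := by
  induction h with
  | refl => exact goodState_init hU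
  | tail _ h ih => exact ih.step hR h

theorem reachable_of_run {α : Type*} {step : α → α → Prop} {f : ℕ → α}
    (hf : ∀ k, step (f k) (f (k + 1))) (k : ℕ) : ReflTransGen step (f 0) (f k) := by
  induction k with
  | zero => exact .refl
  | succ k ih => exact ih.tail (hf k)

theorem Select.card_lt {S S₁ : State ι r K} {w : Vec ι r K} (h : Select lt S w S₁) :
    S₁.gens.card + S₁.pairs.card < S.gens.card + S.pairs.card := by
  cases h <;> simp

/-- Divisibility of terms is a well-quasi-order (Dickson's lemma). -/
theorem wellQuasiOrdered_dvd [Finite ι] :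
    WellQuasiOrdered fun S T : Term ι r => S.1 = T.1 ∧ S.2 ≤ T.2 :=
  (Finite.wellQuasiOrdered (Eq : Fin r → Fin r → Prop)).prod wellQuasiOrdered_le

/-- If infinitely many remainders were non-zero, Dickson's lemma would give an earlier leading term
dividing a later one, against irreducibility, since the earlier remainder is still in the basis.
Otherwise, from some point on, each pass only removes a generator or a pair. The order on terms need
not be well-founded. -/
theorem noInfiniteRun_loopStep [Finite ι] (htot : IsStrictTotalOrder _ lt)
    (hR : IsRemainderFor lt Rem H) {s : ℕ} {U : Fin s → Vec ι r K} (hU : ∀ i, H (U i)) :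
    NoInfiniteRun (LoopStep lt Rem) (State.init U) := by
  rintro ⟨f, hf0, hf⟩
  have hgood : ∀ k, GoodState lt H (f k) := fun k =>
    goodState_of_reachable hR hU (hf0 ▸ reachable_of_run hf k)
  have hf' := hf
  choose w S₁ v hsel hrem hupd using hf'
  have hmono : ∀ k l, k ≤ l → ∀ g ∈ (f k).basis, g ∈ (f l).basis := by
    intro k l hkl
    induction hkl with
    | refl => exact fun g hg => hg
    | @step l _ ih =>
      intro g hg
      rw [hupd l]
      refine basis_subset_update _ _ g ?_
      rw [(hsel l).basis_eq]
      exact ih g hg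
  by_cases hinf : ∃ᶠ k in Filter.atTop, v k ≠ 0
  · obtain ⟨φ, hφ, hv⟩ := Filter.extraction_of_frequently_atTop hinf
    choose T hT using fun n => exists_isLT htot (hv n)
    obtain ⟨k, l, hkl, h1, h2⟩ := wellQuasiOrdered_dvd T
    have hmem : v (φ k) ∈ (f (φ l)).basis := by
      refine hmono (φ k + 1) (φ l) (hφ hkl) _ ?_
      rw [hupd, State.basis_update _ (hv k)]
      exact Multiset.mem_cons_self _ _
    have hw := ((hgood (φ l)).select hR (hsel (φ l))).1
    have hirr := (hR.rem _ _ _ (fun g hg => ((hgood (φ l)).basis g hg).2) hw (hrem (φ l))).2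
    refine hirr _ hmem (T l).1 (T l).2 (T k).2 (hT l) ?_ h2
    rw [← h1]
    exact hT k
  · rw [Filter.not_frequently, Filter.eventually_atTop] at hinf
    obtain ⟨N, hN⟩ := hinf
    have hdec : ∀ k, (f (N + (k + 1))).gens.card + (f (N + (k + 1))).pairs.card
        < (f (N + k)).gens.card + (f (N + k)).pairs.card := by
      intro k
      have h0 : v (N + k) = 0 := not_not.1 (hN (N + k) (Nat.le_add_right _ _))
      rw [← add_assoc, hupd (N + k), h0, State.update_zero]
      exact (hsel (N + k)).card_lt
    exact (wellFounded_iff_isEmpty_descending_chain.1 (wellFounded_lt (α := ℕ))).elim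
      ⟨fun k => (f (N + k)).gens.card + (f (N + k)).pairs.card, hdec⟩

/-- The invariant records that every stored pair has an S-vector, so any leftover generator or pair
can be selected; it remains only to have a remainder. -/
theorem GoodState.exists_loopStep (hR : IsRemainderFor lt Rem H)
    (hex : ∀ G w, (∀ g ∈ G, H g) → H w → ∃ v, Rem G w v) {S : State ι r K}
    (hS : GoodState lt H S) (hfin : ¬ S.IsFinal) : ∃ S', LoopStep lt Rem S S' := by
  have key : ∀ w S₁, Select lt S w S₁ → ∃ S', LoopStep lt Rem S S' := by
    intro w S₁ hsel
    obtain ⟨v, hv⟩ := hex S.basis w (fun g hg => (hS.basis g hg).2) (hS.select hR hsel).1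
    exact ⟨_, w, S₁, v, hsel, hv, rfl⟩
  obtain ⟨gens, pairs, G⟩ := S
  by_cases hg : gens = 0
  · have hp : pairs ≠ 0 := fun hp => hfin ⟨hg, hp⟩
    obtain ⟨p, hp⟩ := Multiset.exists_mem_of_ne_zero hp
    obtain ⟨-, -, w, hw⟩ := hS.pairs p hp
    obtain ⟨pairs, rfl⟩ := Multiset.exists_cons_of_mem hp
    exact key _ _ (Select.pair p.1 p.2 w gens pairs G hw)
  · obtain ⟨u, hu⟩ := Multiset.exists_mem_of_ne_zero hg
    obtain ⟨gens, rfl⟩ := Multiset.exists_cons_of_mem hu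
    exact key _ _ (Select.gen u gens pairs G)

end Loop

/-! ### From finished runs to lcm representations and spans -/

section Correctness

variable {ι κ : Type} {r : ℕ} {K : Type*} [Field K] {D : Type*}
  {lt : Term ι r → Term ι r → Prop} {lt' : Term κ r → Term κ r → Prop} {deg : Term κ r → D}
  {Rem : Multiset (Vec ι r K) → Vec ι r K → Vec ι r K → Prop} {H : Vec ι r K → Prop}
  {φ : Vec ι r K → Vec κ r K}

/-- The map `φ` carries S-vectors and remainders of vectors with the property `H` to S-vectors and,
up to power products, to results of divisions. -/
structure TransfersDivision (lt : Term ι r → Term ι r → Prop) (lt' : Term κ r → Term κ r → Prop)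
    (deg : Term κ r → D) (Rem : Multiset (Vec ι r K) → Vec ι r K → Vec ι r K → Prop)
    (H : Vec ι r K → Prop) (φ : Vec ι r K → Vec κ r K) : Prop where
  map_zero : φ 0 = 0
  sameDeg : ∀ u, H u → SameDeg deg (φ u)
  sVector : ∀ u v w, H u → H v → IsSVector lt u v w → IsSVector lt' (φ u) (φ v) (φ w)
  exists_sVector : ∀ u v w, H u → H v → IsSVector lt' (φ u) (φ v) w → ∃ w', IsSVector lt u v w'
  rem : ∀ G w v, (∀ g ∈ G, H g) → H w → Rem G w v → ∃ c,
    ReflTransGen (DivStep lt' (G.map φ)) (φ w) ((monomial c 1 : MvPolynomial κ K) • φ v)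

/-- Every pair of vectors in `𝒢` is waiting to be processed or has been processed successfully. -/
def PairsProcessed (lt' : Term κ r → Term κ r → Prop) (deg : Term κ r → D)
    (φ : Vec ι r K → Vec κ r K) (S : State ι r K) : Prop :=
  ∀ u ∈ S.basis, ∀ v ∈ S.basis, (u, v) ∈ S.pairs ∨ (v, u) ∈ S.pairs ∨
    SPairReduces lt' deg (φ '' {g | g ∈ S.basis}) (φ u) (φ v)

/-- The image of `w` is the S-vector of the images, hence below the lcm, and the division chain
stays below it. What is left is a power product times `φ R`, itself an admissible multiple of an
element of `G'`. This is why `TransfersDivision` can tolerate the power product. -/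
theorem sPairReduces_of_rem (h : IsCompatible lt' deg)
    (hφ : TransfersDivision lt lt' deg Rem H φ) {G : Multiset (Vec ι r K)} (hG : ∀ g ∈ G, H g)
    {u v w R : Vec ι r K} (hu : H u) (hv : H v) (hw : H w) (hsv : IsSVector lt u v w)
    (hR : Rem G w R) {G' : Set (Vec κ r K)} (hGG' : ∀ g ∈ G, φ g ∈ G') (hRG' : R ≠ 0 → φ R ∈ G') :
    SPairReduces lt' deg G' (φ u) (φ v) := by
  intro i a b ha hb
  obtain ⟨c, hc⟩ := hφ.rem G w R hG hw hR
  have hw' : φ w = sVec (φ u) (φ v) (i, a) (i, b) := by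
    obtain ⟨j, a', b', ha', hb', e⟩ := hφ.sVector u v w hu hv hsv
    obtain ⟨rfl, rfl⟩ := Prod.mk.inj (ha'.unique h.total ha)
    obtain ⟨-, rfl⟩ := Prod.mk.inj (hb'.unique h.total hb)
    exact e
  rw [hw'] at hc
  have hG1 : ∀ g ∈ G.map φ, SameDeg deg g := by
    intro g hg
    obtain ⟨g, hg', rfl⟩ := Multiset.mem_map.1 hg
    exact hφ.sameDeg g (hG g hg')
  obtain ⟨h1, h2⟩ := sub_mem_stdSpan_of_reflTransGen_divStep h hG1
    (termsBelow_sVec h (hφ.sameDeg u hu) (hφ.sameDeg v hv) ha hb) hc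
  have h1' := stdSpan_mono (G' := G') (by
    intro g hg
    obtain ⟨g, hg', rfl⟩ := Multiset.mem_map.1 hg
    exact hGG' g hg') _ h1
  have hmem : (monomial c 1 : MvPolynomial κ K) • φ R ∈ stdSpan lt' deg G' (i, a ⊔ b) := by
    by_cases h0 : φ R = 0
    · simp [h0]
    · have hR0 : R ≠ 0 := fun e => h0 (by rw [e, hφ.map_zero])
      obtain ⟨T, hT⟩ := exists_isLT h.total h0
      have := h2 _ (hT.monomial_smul h c one_ne_zero).1
      exact Submodule.subset_span ⟨_, hRG' hR0, c, T, hT, this.1, this.2, rfl⟩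
  have := add_mem h1' hmem
  rwa [sub_add_cancel] at this

theorem PairsProcessed.step (h : IsCompatible lt' deg)
    (hφ : TransfersDivision lt lt' deg Rem H φ) (hR : IsRemainderFor lt Rem H) {S S' : State ι r K}
    (hS : GoodState lt H S) (hP : PairsProcessed lt' deg φ S) (hs : LoopStep lt Rem S S') :
    PairsProcessed lt' deg φ S' := by
  obtain ⟨w, S₁, R, hsel, hrem, rfl⟩ := hs
  obtain ⟨hw, hS₁⟩ := hS.select hR hsel
  have hRH := (hR.rem _ _ _ (fun g hg => (hS.basis g hg).2) hw hrem).1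
  have hb := hsel.basis_eq
  set G' : Set (Vec κ r K) := φ '' {g | g ∈ (S₁.update lt R).basis} with hG'
  have hGG' : ∀ g ∈ S.basis, φ g ∈ G' := fun g hg =>
    ⟨g, basis_subset_update S₁ R g (hb ▸ hg), rfl⟩
  have hsub : φ '' {g | g ∈ S.basis} ⊆ G' := by
    rintro _ ⟨g, hg, rfl⟩
    exact hGG' g hg
  have hRG' : R ≠ 0 → φ R ∈ G' := fun h0 =>
    ⟨R, by simp [State.basis_update S₁ h0], rfl⟩
  have hpair : ∀ p ∈ S.pairs, p ∈ S₁.pairs ∨ SPairReduces lt' deg G' (φ p.1) (φ p.2) := by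
    intro p hp
    cases hsel with
    | gen _ gens pairs G => exact Or.inl hp
    | pair u v _ gens pairs G hsv =>
      rcases Multiset.mem_cons.1 hp with rfl | hp
      · have := hS.pairs _ (Multiset.mem_cons_self _ _)
        exact Or.inr (sPairReduces_of_rem h hφ (fun g hg => (hS.basis g hg).2) this.1 this.2.1 hw
          hsv hrem hGG' hRG')
      · exact Or.inl hp
  have hold : ∀ p ∈ S₁.pairs, p ∈ (S₁.update lt R).pairs := by
    intro p hp
    by_cases h0 : R = 0
    · rwa [h0, S₁.update_zero]
    · exact (S₁.mem_pairs_update h0).2 (Or.inl hp)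
  have hprev : ∀ u ∈ S.basis, ∀ v ∈ S.basis, (u, v) ∈ (S₁.update lt R).pairs ∨
      (v, u) ∈ (S₁.update lt R).pairs ∨ SPairReduces lt' deg G' (φ u) (φ v) := by
    intro u hu v hv
    rcases hP u hu v hv with hp | hp | hp
    · rcases hpair _ hp with hp | hp
      exacts [Or.inl (hold _ hp), Or.inr (Or.inr hp)]
    · rcases hpair _ hp with hp | hp
      exacts [Or.inr (Or.inl (hold _ hp)), Or.inr (Or.inr hp.symm)]
    · exact Or.inr (Or.inr (hp.mono hsub))
  -- If `R` and `v` have no S-vector, no pair is stored; then the images have no S-vector either,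
  -- and the claim about them is vacuous.
  have hnew : R ≠ 0 → ∀ v ∈ S.basis, (R, v) ∈ (S₁.update lt R).pairs ∨
      SPairReduces lt' deg G' (φ R) (φ v) := by
    intro h0 v hv
    by_cases hsv : ∃ w, IsSVector lt R v w
    · exact Or.inl ((S₁.mem_pairs_update h0).2 (Or.inr ⟨rfl, hb ▸ hv, hsv⟩))
    · refine Or.inr fun i a b ha hb => (hsv ?_).elim
      exact hφ.exists_sVector R v _ hRH (hS.basis v hv).2 ⟨i, a, b, ha, hb, rfl⟩
  have hbasis : ∀ u ∈ (S₁.update lt R).basis, u ∈ S.basis ∨ (R ≠ 0 ∧ u = R) := by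
    intro u hu
    by_cases h0 : R = 0
    · rw [h0, S₁.update_zero, hb] at hu
      exact Or.inl hu
    · rw [S₁.basis_update h0, hb] at hu
      rcases Multiset.mem_cons.1 hu with rfl | hu
      exacts [Or.inr ⟨h0, rfl⟩, Or.inl hu]
  intro u hu v hv
  rcases hbasis u hu with hu' | ⟨h0, rfl⟩ <;> rcases hbasis v hv with hv' | ⟨h0', rfl⟩
  · exact hprev u hu' v hv'
  · rcases hnew h0' u hu' with hp | hp
    exacts [Or.inr (Or.inl hp), Or.inr (Or.inr hp.symm)]
  · rcases hnew h0 v hv' with hp | hp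
    exacts [Or.inl hp, Or.inr (Or.inr hp)]
  · exact Or.inr (Or.inr (SPairReduces.refl h.total _ _))

theorem sPairReduces_of_final (h : IsCompatible lt' deg)
    (hφ : TransfersDivision lt lt' deg Rem H φ) (hR : IsRemainderFor lt Rem H)
    {s : ℕ} {U : Fin s → Vec ι r K} (hU : ∀ i, H (U i)) {S : State ι r K}
    (hS : ReflTransGen (LoopStep lt Rem) (State.init U) S) (hfin : S.IsFinal) :
    ∀ u ∈ φ '' S.output, ∀ v ∈ φ '' S.output, SPairReduces lt' deg (φ '' S.output) u v := by
  have hP : PairsProcessed lt' deg φ S := by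
    clear hfin
    induction hS with
    | refl => intro u hu; simp [State.init] at hu
    | tail h1 h2 ih => exact ih.step h hφ hR (goodState_of_reachable hR hU h1) h2
  rintro _ ⟨u, hu, rfl⟩ _ ⟨v, hv, rfl⟩
  rcases hP u hu v hv with hp | hp | hp
  · simp [hfin.2] at hp
  · simp [hfin.2] at hp
  · exact hp

theorem mem_span_of_reflTransGen_divStep {lt : Term ι r → Term ι r → Prop}
    {G : Multiset (Vec ι r K)} {v v' : Vec ι r K}
    (h : ReflTransGen (DivStep lt G) v v') :
    v - v' ∈ Submodule.span (MvPolynomial ι K) {g | g ∈ G} := by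
  induction h with
  | refl => simp
  | tail _ h ih =>
    obtain ⟨g, hg, i, b, c, -, -, rfl⟩ := h
    rw [sub_sub_eq_add_sub, add_sub_right_comm]
    exact add_mem ih (Submodule.smul_mem _ _ (Submodule.subset_span hg))

/-- If `φ` carries remainders to results of divisions, then the images of the output and of the
input generate the same submodule. -/
theorem span_output_eq (hφ : TransfersDivision lt lt' deg Rem H φ)
    (hrem : ∀ G w v, (∀ g ∈ G, H g) → H w → Rem G w v →
      ReflTransGen (DivStep lt' (G.map φ)) (φ w) (φ v)) (hR : IsRemainderFor lt Rem H)
    {s : ℕ} {U : Fin s → Vec ι r K} (hU : ∀ i, H (U i)) {S : State ι r K}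
    (hS : ReflTransGen (LoopStep lt Rem) (State.init U) S) (hfin : S.IsFinal) :
    Submodule.span (MvPolynomial κ K) (φ '' S.output) = Submodule.span _ (φ '' Set.range U) := by
  set M := Submodule.span (MvPolynomial κ K) (φ '' Set.range U)
  have hmap : ∀ G : Multiset (Vec ι r K), {g | g ∈ G.map φ} = φ '' {g | g ∈ G} := by
    intro G
    ext x
    simp
  -- All images stay in `M`, and each input is still waiting or its image already lies in the span
  -- of the images of the basis. The latter requires remainders without an extra power product,
  -- which is what `hrem` supplies.
  have hinv : (∀ v ∈ S.gens, φ v ∈ M) ∧ (∀ p ∈ S.pairs, φ p.1 ∈ M ∧ φ p.2 ∈ M) ∧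
      (∀ v ∈ S.basis, φ v ∈ M) ∧ ∀ i, U i ∈ S.gens ∨
        φ (U i) ∈ Submodule.span (MvPolynomial κ K) (φ '' {g | g ∈ S.basis}) := by
    clear hfin
    induction hS with
    | refl =>
      refine ⟨?_, by simp [State.init], by simp [State.init], fun i => Or.inl ?_⟩
      · intro v hv
        simp only [State.init, Multiset.mem_map] at hv
        obtain ⟨i, -, rfl⟩ := hv
        exact Submodule.subset_span ⟨_, ⟨i, rfl⟩, rfl⟩
      · simp [State.init]
    | @tail S S' hreach hs ih =>
      have hgood := goodState_of_reachable hR hU hreach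
      obtain ⟨w, S₁, R, hsel, hr, rfl⟩ := hs
      obtain ⟨hw, hS₁⟩ := hgood.select hR hsel
      have hch := mem_span_of_reflTransGen_divStep
        (hrem _ _ _ (fun g hg => (hgood.basis g hg).2) hw hr)
      rw [hmap] at hch
      obtain ⟨i1, i2, i3, i4⟩ := ih
      have hb := hsel.basis_eq
      obtain ⟨hwM, j1, j2, j4⟩ : φ w ∈ M ∧ (∀ v ∈ S₁.gens, φ v ∈ M) ∧
          (∀ p ∈ S₁.pairs, φ p.1 ∈ M ∧ φ p.2 ∈ M) ∧ ∀ i, U i ∈ S.gens → U i ∈ S₁.gens ∨ U i = w := by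
        cases hsel with
        | gen _ gens pairs G =>
          exact ⟨i1 _ (Multiset.mem_cons_self _ _), fun v hv => i1 v (Multiset.mem_cons_of_mem hv),
            i2, fun i hi => (Multiset.mem_cons.1 hi).symm⟩
        | pair u v _ gens pairs G hsv =>
          have hp := hgood.pairs _ (Multiset.mem_cons_self _ _)
          have hM := i2 _ (Multiset.mem_cons_self _ _)
          obtain ⟨_, _, _, -, -, e⟩ := hφ.sVector u v w hp.1 hp.2.1 hsv
          refine ⟨?_, i1, fun p hp => i2 p (Multiset.mem_cons_of_mem hp), fun i hi => Or.inl hi⟩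
          rw [e]
          exact sub_mem (Submodule.smul_mem _ _ hM.1) (Submodule.smul_mem _ _ hM.2)
      have hRM : φ R ∈ M := by
        have hle : Submodule.span (MvPolynomial κ K) (φ '' {g | g ∈ S.basis}) ≤ M := by
          refine Submodule.span_le.2 ?_
          rintro _ ⟨g, hg, rfl⟩
          exact i3 g hg
        have := sub_mem hwM (hle hch)
        rwa [sub_sub_cancel] at this
      have hle : Submodule.span (MvPolynomial κ K) (φ '' {g | g ∈ S.basis}) ≤
          Submodule.span (MvPolynomial κ K) (φ '' {g | g ∈ (S₁.update lt R).basis}) :=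
        Submodule.span_mono (Set.image_mono fun g hg => basis_subset_update S₁ R g (hb ▸ hg))
      have hRs : φ R ∈ Submodule.span (MvPolynomial κ K)
          (φ '' {g | g ∈ (S₁.update lt R).basis}) := by
        by_cases h0 : R = 0
        · simp [h0, hφ.map_zero]
        · exact Submodule.subset_span ⟨R, by simp [State.basis_update S₁ h0], rfl⟩
      have hbasis : ∀ v ∈ (S₁.update lt R).basis, φ v ∈ M := by
        by_cases h0 : R = 0
        · rwa [h0, S₁.update_zero, hb]
        · rw [S₁.basis_update h0, hb]
          intro v hv
          rcases Multiset.mem_cons.1 hv with rfl | hv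
          exacts [hRM, i3 v hv]
      refine ⟨by rwa [S₁.gens_update], ?_, hbasis, fun i => ?_⟩
      · by_cases h0 : R = 0
        · rwa [h0, S₁.update_zero]
        · intro p hp
          rcases (S₁.mem_pairs_update h0).1 hp with hp | ⟨h1, h2, -⟩
          · exact j2 p hp
          · rw [h1]
            exact ⟨hRM, i3 _ (hb ▸ h2)⟩
      · rw [S₁.gens_update]
        rcases i4 i with h | h
        · rcases j4 i h with h | h
          · exact Or.inl h
          · rw [h]
            have := add_mem (hle hch) hRs
            rw [sub_add_cancel] at this
            exact Or.inr this
        · exact Or.inr (hle h)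
  refine le_antisymm (Submodule.span_le.2 ?_) (Submodule.span_le.2 ?_)
  · rintro _ ⟨g, hg, rfl⟩
    exact hinv.2.2.1 g hg
  · rintro _ ⟨_, ⟨i, rfl⟩, rfl⟩
    rcases hinv.2.2.2 i with h | h
    · simp [hfin.1] at h
    · exact h

end Correctness

/-! ### Dehomogenization of terms, S-vectors and divisions -/

section Dehomogenization

variable {m n r : ℕ} {K : Type*} [Field K] {W : Matrix (Fin m) (Fin n) ℤ}
  {δ : Fin r → Fin m → ℤ} {σ : Term (Fin n) r → Term (Fin n) r → Prop}

/-- The exponents of `x_1, …, x_n`. -/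
noncomputable def xPart (e : Fin m ⊕ Fin n →₀ ℕ) : Fin n →₀ ℕ :=
  Finsupp.equivFunOnFinite.symm fun j => e (Sum.inr j)

@[simp] theorem xPart_apply (e : Fin m ⊕ Fin n →₀ ℕ) (j : Fin n) :
    xPart e j = e (Sum.inr j) := rfl

theorem xPart_add (e f : Fin m ⊕ Fin n →₀ ℕ) : xPart (e + f) = xPart e + xPart f := by
  ext j; simp

theorem xPart_tsub (e f : Fin m ⊕ Fin n →₀ ℕ) : xPart (e - f) = xPart e - xPart f := by
  ext j; simp

theorem xPart_sup (e f : Fin m ⊕ Fin n →₀ ℕ) : xPart (e ⊔ f) = xPart e ⊔ xPart f := by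
  ext j; simp

theorem dehTerm_mk (i : Fin r) (e : Fin m ⊕ Fin n →₀ ℕ) : dehTerm (i, e) = (i, xPart e) := rfl

theorem dehTerm_mulTerm (c : Fin m ⊕ Fin n →₀ ℕ) (T : Term (Fin m ⊕ Fin n) r) :
    dehTerm (mulTerm c T) = mulTerm (xPart c) (dehTerm T) :=
  Prod.ext rfl (xPart_add c T.2)

theorem degWbar_mulTerm (c : Fin m ⊕ Fin n →₀ ℕ) (T : Term (Fin m ⊕ Fin n) r) :
    degWbar W δ (mulTerm c T) =
      (fun k => (c (Sum.inl k) : ℤ) + ∑ j, W k j * (c (Sum.inr j) : ℤ)) + degWbar W δ T := by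
  funext k
  simp only [degWbar, mulTerm, Finsupp.add_apply, Nat.cast_add, mul_add, Finset.sum_add_distrib,
    Pi.add_apply]
  ring

theorem degWbar_eq_add_degW (T : Term (Fin m ⊕ Fin n) r) (k : Fin m) :
    degWbar W δ T k = T.2 (Sum.inl k) + degW W δ (dehTerm T) k := by
  simp [degWbar, degW, dehTerm, add_assoc]

/-- Each `y_k` has as degree the `k`-th unit vector, so the degree and the `x`-part determine the
`y`-exponents. Hence the extended ordering is total, and `deh` causes no cancellation in a
homogeneous vector. -/
theorem eq_of_dehTerm_eq {S T : Term (Fin m ⊕ Fin n) r} (hd : degWbar W δ S = degWbar W δ T)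
    (h : dehTerm S = dehTerm T) : S = T := by
  refine Prod.ext (congrArg (fun t => t.1) h) (Finsupp.ext ?_)
  rintro (k | j)
  · have := congrFun hd k
    rw [degWbar_eq_add_degW, degWbar_eq_add_degW, h] at this
    exact_mod_cast add_right_cancel this
  · exact DFunLike.congr_fun (congrArg (fun t => t.2) h) j

theorem isCompatible_of_isModuleOrdering (hσ : IsModuleOrdering σ) :
    IsCompatible σ (fun _ => ()) :=
  ⟨hσ.total, fun c S T h => hσ.mul c S.1 T.1 S.2 T.2 h, fun _ _ _ _ => rfl⟩

theorem isCompatible_extend (hσ : IsModuleOrdering σ) :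
    IsCompatible (extend W δ σ) (degWbar W δ) := by
  have := hσ.total
  refine ⟨{ trichotomous := ?_, irrefl := ?_, trans := ?_ }, ?_, ?_⟩
  · intro S T h1 h2
    rcases lt_trichotomy (toLex (degWbar W δ S)) (toLex (degWbar W δ T)) with h | h | h
    · exact absurd (Or.inl h) h1
    · have h' : degWbar W δ S = degWbar W δ T := toLex.injective h
      refine eq_of_dehTerm_eq h' ?_
      rcases trichotomous_of σ (dehTerm S) (dehTerm T) with h3 | h3 | h3
      · exact absurd (Or.inr ⟨h', h3⟩) h1
      · exact h3
      · exact absurd (Or.inr ⟨h'.symm, h3⟩) h2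
    · exact absurd (Or.inl h) h2
  · rintro S (h | ⟨-, h⟩)
    exacts [lt_irrefl _ h, irrefl_of σ _ h]
  · rintro S T V (h | ⟨h, h'⟩) (g | ⟨g, g'⟩)
    · exact Or.inl (h.trans g)
    · exact Or.inl (g ▸ h)
    · exact Or.inl (h ▸ g)
    · exact Or.inr ⟨h.trans g, trans_of σ h' g'⟩
  · rintro c S T (h | ⟨h, h'⟩)
    · refine Or.inl ?_
      rw [degWbar_mulTerm, degWbar_mulTerm, toLex_add, toLex_add]
      exact add_lt_add_right h _
    · refine Or.inr ⟨by rw [degWbar_mulTerm, degWbar_mulTerm, h], ?_⟩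
      rw [dehTerm_mulTerm, dehTerm_mulTerm]
      exact hσ.mul _ _ _ _ _ h'
  · intro c S T h
    rw [degWbar_mulTerm, degWbar_mulTerm, h]

/-- In an infinite descending chain, Dickson's lemma finds a term dividing a later one; positivity
and compatibility with multiplication make the later one at least as large. -/
theorem wellFounded_of_isModuleTermOrdering {ι : Type} [Finite ι]
    {lt : Term ι r → Term ι r → Prop} (h : IsModuleTermOrdering lt) : WellFounded lt := by
  have := h.total
  rw [wellFounded_iff_isEmpty_descending_chain]
  refine ⟨fun ⟨f, hf⟩ => ?_⟩
  have hlt : ∀ k l, k < l → lt (f l) (f k) := by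
    intro k l hkl
    induction hkl with
    | refl => exact hf k
    | step _ ih => exact trans_of lt (hf _) ih
  obtain ⟨k, l, hkl, h1, h2⟩ := wellQuasiOrdered_dvd f
  have hkl' := hlt k l hkl
  by_cases heq : (f k).2 = (f l).2
  · rw [show f k = f l from Prod.ext h1 heq] at hkl'
    exact irrefl_of lt _ hkl'
  · have h3 := h.mul (f k).2 (f k).1 (f k).1 _ _ (h.pos (f k).1 ((f l).2 - (f k).2)
      fun h0 => heq (le_antisymm h2 (tsub_eq_zero_iff_le.1 h0)))
    rw [add_zero, add_tsub_cancel_of_le h2] at h3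
    have h4 : lt (f k) (f l) := by
      rw [show f l = ((f k).1, (f l).2) from Prod.ext h1.symm rfl]
      exact h3
    exact irrefl_of lt _ (trans_of lt h4 hkl')

theorem aeval_deh_monomial (e : Fin m ⊕ Fin n →₀ ℕ) (k : K) :
    aeval (Sum.elim (fun _ => 1) X : Fin m ⊕ Fin n → MvPolynomial (Fin n) K) (monomial e k)
      = monomial (xPart e) k := by
  rw [aeval_monomial, monomial_eq (s := xPart e), Finsupp.prod_fintype _ _ (fun _ => pow_zero _),
    Finsupp.prod_fintype _ _ (fun _ => pow_zero _), Fintype.prod_sum_type]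
  simp [algebraMap_eq]

theorem deh_zero : deh (0 : Vec (Fin m ⊕ Fin n) r K) = 0 := by
  funext i; simp [deh]

theorem deh_add (U V : Vec (Fin m ⊕ Fin n) r K) : deh (U + V) = deh U + deh V := by
  funext i; simp [deh]

theorem deh_sub (U V : Vec (Fin m ⊕ Fin n) r K) : deh (U - V) = deh U - deh V := by
  funext i; simp [deh]

theorem deh_smul (p : MvPolynomial (Fin m ⊕ Fin n) K) (U : Vec (Fin m ⊕ Fin n) r K) :
    deh (p • U) =
      aeval (Sum.elim (fun _ => 1) X : Fin m ⊕ Fin n → MvPolynomial (Fin n) K) p • deh U := by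
  funext i; simp [deh]

theorem deh_monomial_smul (e : Fin m ⊕ Fin n →₀ ℕ) (k : K) (U : Vec (Fin m ⊕ Fin n) r K) :
    deh (monomial e k • U) = monomial (xPart e) k • deh U := by
  rw [deh_smul, aeval_deh_monomial]

theorem tcoeff_deh_eq_sum (U : Vec (Fin m ⊕ Fin n) r K) (i : Fin r) (a : Fin n →₀ ℕ) :
    tcoeff (deh U) (i, a) = ∑ e ∈ (U i).support, if xPart e = a then coeff e (U i) else 0 := by
  have : deh U i = ∑ e ∈ (U i).support, monomial (xPart e) (coeff e (U i)) := by
    conv_lhs => rw [deh, ← support_sum_monomial_coeff (U i), map_sum]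
    simp only [aeval_deh_monomial]
  simp [tcoeff, this, coeff_sum, coeff_monomial]

theorem exists_of_tcoeff_deh_ne_zero {U : Vec (Fin m ⊕ Fin n) r K} {t : Term (Fin n) r}
    (h : tcoeff (deh U) t ≠ 0) : ∃ T, dehTerm T = t ∧ tcoeff U T ≠ 0 := by
  obtain ⟨i, a⟩ := t
  rw [tcoeff_deh_eq_sum] at h
  obtain ⟨e, he, hne⟩ := Finset.exists_ne_zero_of_sum_ne_zero h
  split_ifs at hne with hea
  · exact ⟨(i, e), by rw [dehTerm_mk, hea], hne⟩
  · exact absurd rfl hne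

theorem tcoeff_deh {U : Vec (Fin m ⊕ Fin n) r K} {T : Term (Fin m ⊕ Fin n) r}
    (h : ∀ S, tcoeff U S ≠ 0 → degWbar W δ S = degWbar W δ T) :
    tcoeff (deh U) (dehTerm T) = tcoeff U T := by
  obtain ⟨i, e⟩ := T
  rw [dehTerm_mk, tcoeff_deh_eq_sum, Finset.sum_eq_single e]
  · simp [tcoeff]
  · intro f hf hfe
    refine if_neg fun hx => hfe ?_
    have h' := h (i, f) (by simpa [tcoeff] using hf)
    exact congrArg Prod.snd (eq_of_dehTerm_eq h' (by rw [dehTerm_mk, dehTerm_mk, hx]))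
  · intro he
    simpa using he

theorem IsHomog.sameDeg {U : Vec (Fin m ⊕ Fin n) r K} (h : IsHomog W δ U) :
    SameDeg (degWbar W δ) U := by
  obtain ⟨d, hd⟩ := h
  exact fun S T hS hT => (hd S hS).trans (hd T hT).symm

theorem SameDeg.isHomog {U : Vec (Fin m ⊕ Fin n) r K} (h : SameDeg (degWbar W δ) U) :
    IsHomog W δ U := by
  by_cases h0 : U = 0
  · exact ⟨0, by simp [h0]⟩
  · obtain ⟨T, hT⟩ := exists_tcoeff_ne_zero h0
    exact ⟨degWbar W δ T, fun S hS => h S T hS hT⟩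

theorem IsHomog.tcoeff_deh {U : Vec (Fin m ⊕ Fin n) r K} (h : IsHomog W δ U)
    {T : Term (Fin m ⊕ Fin n) r} (hT : tcoeff U T ≠ 0) :
    tcoeff (deh U) (dehTerm T) = tcoeff U T :=
  SatBA.tcoeff_deh fun S hS => h.sameDeg S T hS hT

theorem IsHomog.deh_ne_zero {U : Vec (Fin m ⊕ Fin n) r K} (h : IsHomog W δ U) (h0 : U ≠ 0) :
    deh U ≠ 0 := by
  obtain ⟨T, hT⟩ := exists_tcoeff_ne_zero h0
  intro hd
  have := h.tcoeff_deh hT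
  rw [hd, tcoeff_zero] at this
  exact hT this.symm

theorem eq_of_deh_eq {U V : Vec (Fin m ⊕ Fin n) r K} {d : Fin m → ℤ}
    (hU : ∀ T, tcoeff U T ≠ 0 → degWbar W δ T = d) (hV : ∀ T, tcoeff V T ≠ 0 → degWbar W δ T = d)
    (h : deh U = deh V) : U = V := by
  refine vec_ext fun T => ?_
  by_cases hT : degWbar W δ T = d
  · rw [← tcoeff_deh (W := W) (δ := δ) (U := U) (fun S hS => (hU S hS).trans hT.symm), h,
      tcoeff_deh (W := W) (δ := δ) (fun S hS => (hV S hS).trans hT.symm)]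
  · rw [not_imp_comm.1 (hU T) hT, not_imp_comm.1 (hV T) hT]

/-- All terms of `U` have one degree, where the extended ordering is decided by `σ` on the
dehomogenized terms. -/
theorem IsHomog.isLT_deh {U : Vec (Fin m ⊕ Fin n) r K} (h : IsHomog W δ U)
    {T : Term (Fin m ⊕ Fin n) r} (hT : IsLT (extend W δ σ) U T) :
    IsLT σ (deh U) (dehTerm T) := by
  refine ⟨by rw [h.tcoeff_deh hT.1]; exact hT.1, fun t ht => ?_⟩
  obtain ⟨S, rfl, hS⟩ := exists_of_tcoeff_deh_ne_zero ht
  have hd := h.sameDeg S T hS hT.1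
  rcases hT.2 S hS with rfl | hlt | ⟨-, hlt⟩
  · exact Or.inl rfl
  · rw [hd] at hlt
    exact absurd hlt (lt_irrefl _)
  · exact Or.inr hlt

theorem IsHomog.exists_isLT_of_deh (hσ : IsModuleOrdering σ) {U : Vec (Fin m ⊕ Fin n) r K}
    (h : IsHomog W δ U) {t : Term (Fin n) r} (ht : IsLT σ (deh U) t) :
    ∃ T, IsLT (extend W δ σ) U T ∧ dehTerm T = t := by
  have hU : U ≠ 0 := by
    rintro rfl
    exact ht.ne_zero deh_zero
  obtain ⟨T, hT⟩ := exists_isLT (isCompatible_extend (W := W) (δ := δ) hσ).total hU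
  exact ⟨T, hT, (h.isLT_deh hT).unique hσ.total ht⟩

/-- Taking the `x`-part commutes with lcm and with truncated subtraction of exponents, and leading
coefficients survive `deh`. -/
theorem IsSVector.map_deh {u v w : Vec (Fin m ⊕ Fin n) r K} (hu : IsHomog W δ u)
    (hv : IsHomog W δ v) (h : IsSVector (extend W δ σ) u v w) :
    IsSVector σ (deh u) (deh v) (deh w) := by
  obtain ⟨i, a, b, ha, hb, rfl⟩ := h
  have h1 := hu.isLT_deh ha
  have h2 := hv.isLT_deh hb
  rw [dehTerm_mk] at h1 h2
  refine ⟨i, xPart a, xPart b, h1, h2, ?_⟩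
  have e := hu.tcoeff_deh ha.1
  have e' := hv.tcoeff_deh hb.1
  rw [dehTerm_mk] at e e'
  rw [deh_sub, deh_monomial_smul, deh_monomial_smul, xPart_tsub, xPart_tsub, xPart_sup, e, e']

theorem IsSVector.isHomog (hσ : IsModuleOrdering σ) {u v w : Vec (Fin m ⊕ Fin n) r K}
    (hu : IsHomog W δ u) (hv : IsHomog W δ v) (h : IsSVector (extend W δ σ) u v w) :
    IsHomog W δ w := by
  obtain ⟨i, a, b, ha, hb, rfl⟩ := h
  have := termsBelow_sVec (isCompatible_extend hσ) hu.sameDeg hv.sameDeg ha hb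
  exact ⟨_, fun T hT => (this T hT).2⟩

theorem DivStep.map_deh {G : Multiset (Vec (Fin m ⊕ Fin n) r K)} (hG : ∀ g ∈ G, IsHomog W δ g)
    {v v' : Vec (Fin m ⊕ Fin n) r K} (hv : IsHomog W δ v)
    (h : DivStep (extend W δ σ) G v v') : DivStep σ (G.map deh) (deh v) (deh v') := by
  obtain ⟨g, hg, i, b, c, hb, hne, rfl⟩ := h
  have e := hv.tcoeff_deh hne
  rw [dehTerm_mk, xPart_add] at e
  have e' := (hG g hg).tcoeff_deh hb.1
  rw [dehTerm_mk] at e'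
  have h1 := (hG g hg).isLT_deh hb
  rw [dehTerm_mk] at h1
  refine ⟨_, Multiset.mem_map_of_mem _ hg, i, xPart b, xPart c, h1, by rwa [e], ?_⟩
  rw [deh_sub, deh_monomial_smul, e, e']

end Dehomogenization

/-! ### Saturation and saturating remainders -/

section Saturation

variable {m n r : ℕ} {K : Type*} [Field K] {W : Matrix (Fin m) (Fin n) ℤ}
  {δ : Fin r → Fin m → ℤ} {σ : Term (Fin n) r → Term (Fin n) r → Prop}

theorem deh_hom (v : Vec (Fin n) r K) : deh (hom W δ v) = v := by
  funext i
  simp only [deh, hom, map_sum, aeval_deh_monomial]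
  conv_rhs => rw [← support_sum_monomial_coeff (v i)]
  refine Finset.sum_congr rfl fun a _ => congrArg (fun e => monomial e _) ?_
  ext j
  simp

theorem deh_sat (U : Vec (Fin m ⊕ Fin n) r K) : deh (sat W δ U) = deh U := deh_hom _

theorem hom_zero : hom W δ (0 : Vec (Fin n) r K) = 0 := by
  funext i
  simp [hom]

theorem degW_le_topDeg {v : Vec (Fin n) r K} {t : Term (Fin n) r} (ht : tcoeff v t ≠ 0)
    (k : Fin m) : degW W δ t k ≤ topDeg W δ v k := by
  refine le_csSup (Set.Finite.bddAbove ?_) ⟨t, ht, rfl⟩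
  refine ((finite_terms v).image fun T => degW W δ T k).subset ?_
  rintro _ ⟨T, hT, rfl⟩
  exact ⟨T, hT, rfl⟩

/-- Non-vanishing is essential: the supremum of the empty set of integers is the default value 0. -/
theorem topDeg_le {v : Vec (Fin n) r K} (hv : v ≠ 0) {d : ℤ} {k : Fin m}
    (h : ∀ t, tcoeff v t ≠ 0 → degW W δ t k ≤ d) : topDeg W δ v k ≤ d := by
  obtain ⟨t, ht⟩ := exists_tcoeff_ne_zero hv
  refine csSup_le ⟨_, t, ht, rfl⟩ ?_
  rintro _ ⟨T, hT, rfl⟩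
  exact h T hT

/-- The exponents `topDeg - deg` are non-negative on the support, so `toNat` truncates nothing. -/
theorem degWbar_of_tcoeff_hom_ne_zero {v : Vec (Fin n) r K} {T : Term (Fin m ⊕ Fin n) r}
    (hT : tcoeff (hom W δ v) T ≠ 0) : degWbar W δ T = topDeg W δ v := by
  obtain ⟨i, e⟩ := T
  simp only [tcoeff, hom, coeff_sum, coeff_monomial] at hT
  obtain ⟨a, ha, hne⟩ := Finset.exists_ne_zero_of_sum_ne_zero hT
  split_ifs at hne with hea
  · funext k
    have hle := degW_le_topDeg (W := W) (δ := δ) (v := v) (t := (i, a)) hne k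
    have hx : dehTerm (i, e) = (i, a) := by
      rw [dehTerm_mk, ← hea]
      refine Prod.ext rfl (Finsupp.ext fun j => ?_)
      simp
    rw [degWbar_eq_add_degW, hx, ← hea]
    simp [Int.toNat_of_nonneg (sub_nonneg.2 hle)]
  · exact absurd rfl hne

theorem isHomog_sat (U : Vec (Fin m ⊕ Fin n) r K) : IsHomog W δ (sat W δ U) :=
  ⟨_, fun _ hT => degWbar_of_tcoeff_hom_ne_zero hT⟩

/-- A homogeneous vector is the product of its saturation and a power product. -/
theorem IsHomog.exists_eq_monomial_smul_sat {U : Vec (Fin m ⊕ Fin n) r K} (h : IsHomog W δ U) :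
    ∃ c, U = (monomial c 1 : MvPolynomial (Fin m ⊕ Fin n) K) • sat W δ U := by
  by_cases h0 : U = 0
  · exact ⟨0, by rw [h0, sat, deh_zero, hom_zero, smul_zero]⟩
  have h0' := h.deh_ne_zero h0
  obtain ⟨d, hd⟩ := h
  have hle : ∀ k, topDeg W δ (deh U) k ≤ d k := by
    refine fun k => topDeg_le h0' fun t ht => ?_
    obtain ⟨T, rfl, hT⟩ := exists_of_tcoeff_deh_ne_zero ht
    rw [← hd T hT, degWbar_eq_add_degW]
    simp
  -- The `y`-exponent is the excess of the degree `d` of `U` over the top degree of `deh U`. Both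
  -- sides then have degree `d` and the same dehomogenization, which determines them.
  refine ⟨Finsupp.equivFunOnFinite.symm
    (Sum.elim (fun k => (d k - topDeg W δ (deh U) k).toNat) 0), eq_of_deh_eq hd ?_ ?_⟩
  · intro T hT
    obtain ⟨S, rfl, hS⟩ := exists_of_tcoeff_monomial_smul_ne_zero hT
    rw [degWbar_mulTerm, degWbar_of_tcoeff_hom_ne_zero hS]
    funext k
    simp [hle k]
  · rw [deh_monomial_smul, deh_sat]
    have hx : xPart (Finsupp.equivFunOnFinite.symm
        (Sum.elim (fun k => (d k - topDeg W δ (deh U) k).toNat) 0 : Fin m ⊕ Fin n → ℕ)) = 0 := by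
      ext j; simp
    rw [hx]
    exact (one_smul _ _).symm

theorem SameSat.refl {V : Vec (Fin m ⊕ Fin n) r K} (h : IsHomog W δ V) : SameSat W δ V V :=
  ⟨h, rfl⟩

/-- Since `deh` undoes `hom`, the saturation determines the dehomogenization: saturating
replacements are invisible after `deh`. -/
theorem SameSat.deh_eq {V V' : Vec (Fin m ⊕ Fin n) r K} (h : SameSat W δ V V') :
    deh V' = deh V := by
  rw [← deh_sat (W := W) (δ := δ) V', h.2, deh_sat]

theorem sameSat_sat (V : Vec (Fin m ⊕ Fin n) r K) : SameSat W δ V (sat W δ V) :=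
  ⟨isHomog_sat V, by rw [sat, deh_sat]; rfl⟩

theorem WeakSatDivStep.map_deh {G : Multiset (Vec (Fin m ⊕ Fin n) r K)}
    (hG : ∀ g ∈ G, IsHomog W δ g) {v v' : Vec (Fin m ⊕ Fin n) r K}
    (h : WeakSatDivStep W δ σ G v v') : DivStep σ (G.map deh) (deh v) (deh v') := by
  obtain ⟨u, hu, hs⟩ := h
  rw [← hu.deh_eq]
  exact hs.map_deh hG hu.1

theorem IsWeakSatRem.map_deh {G : Multiset (Vec (Fin m ⊕ Fin n) r K)}
    (hG : ∀ g ∈ G, IsHomog W δ g) {v R : Vec (Fin m ⊕ Fin n) r K}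
    (h : IsWeakSatRem W δ σ G v R) : ReflTransGen (DivStep σ (G.map deh)) (deh v) (deh R) := by
  obtain ⟨v', hv', hR, -⟩ := h
  rw [hR.deh_eq]
  exact hv'.lift _ fun _ _ hs => hs.map_deh hG

theorem isHomog_of_reflTransGen_divStep (hσ : IsModuleOrdering σ)
    {G : Multiset (Vec (Fin m ⊕ Fin n) r K)}
    (hG : ∀ g ∈ G, IsHomog W δ g) {v R : Vec (Fin m ⊕ Fin n) r K} (hv : IsHomog W δ v)
    (h : ReflTransGen (DivStep (extend W δ σ) G) v R) : IsHomog W δ R :=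
  (sameDeg_of_reflTransGen_divStep (isCompatible_extend hσ) (fun g hg => (hG g hg).sameDeg)
    hv.sameDeg h).isHomog

theorem reflTransGen_weakSatDivStep (hσ : IsModuleOrdering σ)
    {G : Multiset (Vec (Fin m ⊕ Fin n) r K)}
    (hG : ∀ g ∈ G, IsHomog W δ g) {v R : Vec (Fin m ⊕ Fin n) r K} (hv : IsHomog W δ v)
    (h : ReflTransGen (DivStep (extend W δ σ) G) v R) :
    ReflTransGen (WeakSatDivStep W δ σ G) v R := by
  induction h with
  | refl => exact .refl
  | tail h hs ih =>
    exact ih.tail ⟨_, .refl (isHomog_of_reflTransGen_divStep hσ hG hv h), hs⟩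

theorem IsRem.isWeakSatRem (hσ : IsModuleOrdering σ) {G : Multiset (Vec (Fin m ⊕ Fin n) r K)}
    (hG : ∀ g ∈ G, IsHomog W δ g) {v R : Vec (Fin m ⊕ Fin n) r K} (hv : IsHomog W δ v)
    (h : IsRem (extend W δ σ) G v R) : IsWeakSatRem W δ σ G v R :=
  ⟨R, reflTransGen_weakSatDivStep hσ hG hv h.1,
    .refl (isHomog_of_reflTransGen_divStep hσ hG hv h.1), h.2⟩

/-- The saturation of an irreducible homogeneous vector is irreducible. -/
theorem HeadIrreducible.map_sat (hσ : IsModuleOrdering σ) {G : Multiset (Vec (Fin m ⊕ Fin n) r K)}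
    {R : Vec (Fin m ⊕ Fin n) r K} (hR : IsHomog W δ R) (h : HeadIrreducible (extend W δ σ) G R) :
    HeadIrreducible (extend W δ σ) G (sat W δ R) := by
  obtain ⟨c, hc⟩ := hR.exists_eq_monomial_smul_sat
  intro g hg i a b ha hb hle
  -- The leading term of `R` is `X^c` times that of its saturation, so any divisor of the latter
  -- also divides the former.
  have := ha.monomial_smul (isCompatible_extend hσ) c (one_ne_zero (α := K))
  rw [← hc] at this
  exact h g hg i (c + a) b this hb (hle.trans le_add_self)

/-- The saturation counts as the replacement allowed at the end of a weak division. -/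
theorem IsSatRem.isWeakSatRem (hσ : IsModuleOrdering σ) {G : Multiset (Vec (Fin m ⊕ Fin n) r K)}
    (hG : ∀ g ∈ G, IsHomog W δ g) {v R : Vec (Fin m ⊕ Fin n) r K} (hv : IsHomog W δ v)
    (h : IsSatRem W δ σ G v R) : IsWeakSatRem W δ σ G v R := by
  obtain ⟨R', hR', rfl⟩ := h
  exact ⟨R', reflTransGen_weakSatDivStep hσ hG hv hR'.1, sameSat_sat R',
    hR'.2.map_sat hσ (isHomog_of_reflTransGen_divStep hσ hG hv hR'.1)⟩

end Saturation

/-! ### Correctness of the two algorithms -/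

section Algorithms

variable {m n r : ℕ} {K : Type*} [Field K] {W : Matrix (Fin m) (Fin n) ℤ}
  {δ : Fin r → Fin m → ℤ} {σ : Term (Fin n) r → Term (Fin n) r → Prop}
  {Rem : Multiset (Vec (Fin m ⊕ Fin n) r K) → Vec (Fin m ⊕ Fin n) r K →
    Vec (Fin m ⊕ Fin n) r K → Prop}

/-- On homogeneous vectors, `Rem` yields weak saturating remainders. -/
def IsWeaklySaturating (W : Matrix (Fin m) (Fin n) ℤ) (δ : Fin r → Fin m → ℤ)
    (σ : Term (Fin n) r → Term (Fin n) r → Prop)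
    (Rem : Multiset (Vec (Fin m ⊕ Fin n) r K) → Vec (Fin m ⊕ Fin n) r K →
      Vec (Fin m ⊕ Fin n) r K → Prop) : Prop :=
  ∀ G w v, (∀ g ∈ G, IsHomog W δ g) → IsHomog W δ w → Rem G w v → IsWeakSatRem W δ σ G w v

theorem isRemainderFor_isHomog (hσ : IsModuleOrdering σ) (hRem : IsWeaklySaturating W δ σ Rem) :
    IsRemainderFor (extend W δ σ) Rem (IsHomog W δ) where
  sVector u v w hu hv h := h.isHomog hσ hu hv
  rem G w v hG hw h := by
    obtain ⟨_, -, hs, hirr⟩ := hRem G w v hG hw h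
    exact ⟨hs.1, hirr⟩

theorem transfersDivision_deh (hσ : IsModuleOrdering σ) (hRem : IsWeaklySaturating W δ σ Rem) :
    TransfersDivision (extend W δ σ) σ (fun _ => ()) Rem (IsHomog W δ) deh where
  map_zero := deh_zero
  sameDeg _ _ _ _ _ _ := rfl
  sVector u v w hu hv h := h.map_deh hu hv
  exists_sVector u v w hu hv h := by
    obtain ⟨i, a, b, ha, hb, -⟩ := h
    obtain ⟨⟨j, a'⟩, ha', e⟩ := hu.exists_isLT_of_deh hσ ha
    obtain ⟨⟨j', b'⟩, hb', e'⟩ := hv.exists_isLT_of_deh hσ hb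
    obtain rfl : j = i := congrArg Prod.fst e
    obtain rfl : j' = j := congrArg Prod.fst e'
    exact ⟨_, _, _, _, ha', hb', rfl⟩
  rem G w v hG hw h := by
    refine ⟨0, ?_⟩
    have e : (monomial 0 1 : MvPolynomial (Fin n) K) • deh v = deh v := one_smul _ _
    rw [e]
    exact (hRem G w v hG hw h).map_deh hG

/-- The power product absorbs the saturation: the ordinary remainder is `X^c` times the saturated
one, and the division chain ends there. -/
theorem transfersDivision_id (hσ : IsModuleOrdering σ) :
    TransfersDivision (extend W δ σ) (extend W δ σ) (degWbar W δ)
      (IsSatRem (K := K) W δ σ) (IsHomog W δ) id where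
  map_zero := rfl
  sameDeg _ hu := hu.sameDeg
  sVector _ _ _ _ _ h := h
  exists_sVector _ _ w _ _ h := ⟨w, h⟩
  rem G w v hG hw h := by
    obtain ⟨R, hR, rfl⟩ := h
    obtain ⟨c, hc⟩ := (isHomog_of_reflTransGen_divStep hσ hG hw hR.1).exists_eq_monomial_smul_sat
    refine ⟨c, ?_⟩
    rw [Multiset.map_id, id, id, ← hc]
    exact hR.1

theorem dehMod_span (s : Set (Vec (Fin m ⊕ Fin n) r K)) :
    dehMod (Submodule.span _ s) = Submodule.span _ (deh '' s) := by
  refine le_antisymm (Submodule.span_le.2 ?_)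
    (Submodule.span_mono (Set.image_mono Submodule.subset_span))
  rintro _ ⟨U, hU, rfl⟩
  induction hU using Submodule.span_induction with
  | mem U hU => exact Submodule.subset_span ⟨U, hU, rfl⟩
  | zero => rw [deh_zero]; exact zero_mem _
  | add U V _ _ hU hV => rw [deh_add]; exact add_mem hU hV
  | smul p U _ hU => rw [deh_smul]; exact Submodule.smul_mem _ _ hU

theorem span_deh_output_eq (hσ : IsModuleOrdering σ) (hRem : IsWeaklySaturating W δ σ Rem)
    {s : ℕ} {U : Fin s → Vec (Fin m ⊕ Fin n) r K} (hU : ∀ i, IsHomog W δ (U i))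
    {S : State (Fin m ⊕ Fin n) r K}
    (hS : ReflTransGen (LoopStep (extend W δ σ) Rem) (State.init U) S) (hfin : S.IsFinal) :
    Submodule.span _ (deh '' S.output) = dehMod (Submodule.span _ (Set.range U)) := by
  rw [dehMod_span]
  exact span_output_eq (transfersDivision_deh hσ hRem)
    (fun G w v hG hw h => (hRem G w v hG hw h).map_deh hG) (isRemainderFor_isHomog hσ hRem) hU hS hfin

theorem finite_output {ι : Type} (S : State ι r K) : S.output.Finite :=
  Multiset.finite_toSet S.basis

theorem noInfiniteRun_divStep_extend (hσ : IsModuleOrdering σ)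
    (hwf : WellFounded fun S T => extend W δ σ S T ∧ degWbar W δ S = degWbar W δ T)
    {G : Multiset (Vec (Fin m ⊕ Fin n) r K)} (hG : ∀ g ∈ G, IsHomog W δ g)
    {w : Vec (Fin m ⊕ Fin n) r K} (hw : IsHomog W δ w) :
    NoInfiniteRun (DivStep (extend W δ σ) G) w :=
  noInfiniteRun_divStep (isCompatible_extend hσ) hwf (fun g hg => (hG g hg).sameDeg) hw.sameDeg

theorem exists_isRem (hσ : IsModuleOrdering σ)
    (hwf : WellFounded fun S T => extend W δ σ S T ∧ degWbar W δ S = degWbar W δ T)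
    {G : Multiset (Vec (Fin m ⊕ Fin n) r K)} (hG : ∀ g ∈ G, IsHomog W δ g)
    {w : Vec (Fin m ⊕ Fin n) r K} (hw : IsHomog W δ w) : ∃ R, IsRem (extend W δ σ) G w R := by
  obtain ⟨R, hR, hirr⟩ :=
    exists_reflTransGen_of_noInfiniteRun (noInfiniteRun_divStep_extend hσ hwf hG hw)
  exact ⟨R, hR, headIrreducible_of_forall_not_divStep hirr⟩

theorem wellFounded_extend_of_left (hσ : IsModuleTermOrdering σ) :
    WellFounded fun S T => extend W δ σ S T ∧ degWbar W δ S = degWbar W δ T := by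
  refine Subrelation.wf ?_ (InvImage.wf dehTerm (wellFounded_of_isModuleTermOrdering hσ))
  rintro S T ⟨h | ⟨-, h⟩, hd⟩
  · rw [hd] at h
    exact absurd h (lt_irrefl _)
  · exact h

theorem wellFounded_extend_of_right (hσ : IsModuleTermOrdering (extend W δ σ)) :
    WellFounded fun S T => extend W δ σ S T ∧ degWbar W δ S = degWbar W δ T :=
  Subrelation.wf (fun h => h.1) (wellFounded_of_isModuleTermOrdering hσ)

theorem weakSelfSatBAComputes_isDehomBasis (hσ : IsModuleTermOrdering σ) {s : ℕ}
    {U : Fin s → Vec (Fin m ⊕ Fin n) r K} (hU : ∀ i, IsHomog W δ (U i)) :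
    WeakSelfSatBAComputes W δ σ U (IsDehomBasis W δ σ (Submodule.span _ (Set.range U))) := by
  have hσ' := hσ.toIsModuleOrdering
  have hRem : IsWeaklySaturating (K := K) W δ σ (IsWeakSatRem W δ σ) := fun _ _ _ _ _ h => h
  have hR := isRemainderFor_isHomog hσ' hRem
  have hc := isCompatible_of_isModuleOrdering hσ'
  -- With a constant degree, the criterion asks for `σ` itself to be well-founded.
  have hwf : WellFounded fun S T => σ S T ∧ (fun _ => ()) S = (fun _ => ()) T :=
    Subrelation.wf (fun h => h.1) (wellFounded_of_isModuleTermOrdering hσ)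
  refine ⟨?_, ?_, ?_, ?_⟩
  · rintro S hS w S₁ - ⟨f, hf0, hf⟩
    have hgood := goodState_of_reachable hR hU hS
    -- An infinite weak division would dehomogenize, step by step, to an infinite ordinary division
    -- for `σ`.
    refine noInfiniteRun_divStep hc hwf (G := S.basis.map deh) (v := deh w)
      (fun _ _ _ _ _ _ => rfl) (fun _ _ _ _ => rfl) ⟨fun k => deh (f k), congrArg deh hf0, fun k => ?_⟩
    exact (hf k).map_deh fun g hg => (hgood.basis g hg).2
  · exact noInfiniteRun_loopStep (isCompatible_extend hσ').total hR hU
  · intro S hS hfin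
    refine (goodState_of_reachable hR hU hS).exists_loopStep hR (fun G w hG hw => ?_) hfin
    obtain ⟨R, hrem⟩ := exists_isRem hσ' (wellFounded_extend_of_left hσ) hG hw
    exact ⟨R, hrem.isWeakSatRem hσ' hG hw⟩
  · intro S hS hfin
    have hgood := goodState_of_reachable hR hU hS
    refine ⟨finite_output S, hgood.basis, ?_⟩
    rw [← span_deh_output_eq hσ' hRem hU hS hfin]
    refine isGroebnerBasis_of_sPairReduces hc hwf ((finite_output S).image _) ?_
      (fun _ _ _ _ _ _ => rfl)
      (sPairReduces_of_final hc (transfersDivision_deh hσ' hRem) hR hU hS hfin)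
    rintro _ ⟨g, hg, rfl⟩
    exact (hgood.basis g hg).2.deh_ne_zero (hgood.basis g hg).1

theorem isGraded_span {s : Set (Vec (Fin m ⊕ Fin n) r K)} (hs : ∀ v ∈ s, IsHomog W δ v) :
    IsGraded W δ (Submodule.span _ s) :=
  le_antisymm (Submodule.span_le.2 fun _ h => h.1)
    (Submodule.span_mono fun v hv => ⟨Submodule.subset_span hv, hs v hv⟩)

theorem selfSatBAComputes_isSatGBasis (hσ : IsModuleOrdering σ)
    (hwf : WellFounded fun S T => extend W δ σ S T ∧ degWbar W δ S = degWbar W δ T) {s : ℕ}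
    {U : Fin s → Vec (Fin m ⊕ Fin n) r K} (hU : ∀ i, IsHomog W δ (U i)) :
    SelfSatBAComputes W δ σ U (IsSatGBasis W δ σ (Submodule.span _ (Set.range U))) := by
  have hRem : IsWeaklySaturating (K := K) W δ σ (IsSatRem W δ σ) :=
    fun _ _ _ hG hw h => h.isWeakSatRem hσ hG hw
  have hR := isRemainderFor_isHomog hσ hRem
  have hc := isCompatible_extend (W := W) (δ := δ) hσ
  refine ⟨?_, ?_, ?_, ?_⟩
  · intro S hS w S₁ hsel
    have hgood := goodState_of_reachable hR hU hS
    exact noInfiniteRun_divStep_extend hσ hwf (fun g hg => (hgood.basis g hg).2)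
      (hgood.select hR hsel).1
  · exact noInfiniteRun_loopStep hc.total hR hU
  · intro S hS hfin
    refine (goodState_of_reachable hR hU hS).exists_loopStep hR (fun G w hG hw => ?_) hfin
    obtain ⟨R, hrem⟩ := exists_isRem hσ hwf hG hw
    exact ⟨_, R, hrem, rfl⟩
  · intro S hS hfin
    have hgood := goodState_of_reachable hR hU hS
    have hpairs := sPairReduces_of_final hc (transfersDivision_id hσ) hR hU hS hfin
    rw [Set.image_id] at hpairs
    -- The witness is the span of the output itself; its saturation depends only on its
    -- dehomogenization, which agrees with that of the input module.
    refine ⟨hgood.basis, Submodule.span _ S.output,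
      isGraded_span fun v hv => (hgood.basis v hv).2, ?_, ?_⟩
    · rw [satMod, satMod, dehMod_span, span_deh_output_eq hσ hRem hU hS hfin]
    · exact isGroebnerBasis_of_sPairReduces hc hwf (finite_output S)
        (fun g hg => (hgood.basis g hg).1) (fun g hg => (hgood.basis g hg).2.sameDeg) hpairs

end Algorithms

end SatBA

/-! ### The main theorem -/

theorem mainTheorem2 {K : Type*} [Field K] {m n r s : ℕ}
    (W : Matrix (Fin m) (Fin n) ℤ) (δ : Fin r → Fin m → ℤ)
    (σ : SatBA.Term (Fin n) r → SatBA.Term (Fin n) r → Prop) (hσ : SatBA.IsModuleOrdering σ)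
    (U : Fin s → SatBA.Vec (Fin m ⊕ Fin n) r K) (hU : ∀ i, SatBA.IsHomog W δ (U i))
    (N : Submodule (MvPolynomial (Fin m ⊕ Fin n) K) (SatBA.Vec (Fin m ⊕ Fin n) r K))
    (hN : N = Submodule.span _ (Set.range U)) :
    (SatBA.IsModuleTermOrdering σ →
      SatBA.WeakSelfSatBAComputes W δ σ U (SatBA.IsDehomBasis W δ σ N)) ∧
    (SatBA.IsModuleTermOrdering σ ∨ SatBA.IsModuleTermOrdering (SatBA.extend W δ σ) →
      SatBA.SelfSatBAComputes W δ σ U (SatBA.IsSatGBasis W δ σ N)) := by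
  subst hN
  refine ⟨fun h => SatBA.weakSelfSatBAComputes_isDehomBasis h hU, fun h =>
    SatBA.selfSatBAComputes_isSatGBasis hσ ?_ hU⟩
  exact h.elim SatBA.wellFounded_extend_of_left SatBA.wellFounded_extend_of_right
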